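/- Let $E=(E^0,E^1,r,s)$ be a directed graph with countable sets $E^0$ of vertices and $E^1$ of edges and with range and source maps $r,s:E^1\to E^0$. Suppose that $E$ is locally finite (every vertex emits and receives only finitely many edges) and has no sources (every vertex receives an edge). Let $A=C^*(E)$ be the graph $C^*$-algebra, that is, the universal $C^*$-algebra generated by mutually orthogonal projections $p_v$ ($v\in E^0$) and partial isometries $S_e$ ($e\in E^1$) with $S_e^*S_e=p_{r(e)}$ for all $e$ and $p_v=\sum_{s(e)=v}S_eS_e^*$ whenever $v$ emits an edge. Let $\gamma$ be the gauge action of the circle on $A$, given by $\gamma_z(S_e)=zS_e$ and $\gamma_z(p_v)=p_v$, let $F=C^*(E)^\gamma$ be its fixed point algebra and $\Phi(a)=\frac1{2\pi}\int_0^{2\pi}\gamma_{e^{i\theta}}(a)\,d\theta$ the expectation of $A$ onto $F$. Let $X$ be the right $C^*$-$F$-module obtained by completing $A$, with right multiplication by $F$ and the inner product $(a|b)=\Phi(a^*b)$, in the norm $\|x\|^2=\|\Phi(x^*x)\|$; left multiplication makes $A$ act on $X$. The gauge action extends to $X$; for $k\in\mathbf Z$ put $\Phi_k(x)=\frac1{2\pi}\int_0^{2\pi}e^{-ik\theta}\gamma_{e^{i\theta}}(x)\,d\theta$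 and $x_k=\Phi_k(x)$, and let $\mathcal D$ be the generator of the gauge action on $X$, i.e. $\mathcal Dx=\sum_{k\in\mathbf Z}kx_k$ with domain the set of all $x\in X$ for which $\sum_{k\in\mathbf Z}k^2(x_k|x_k)$ converges in norm. Then $V=\mathcal D(1+\mathcal D^2)^{-1/2}$ is a well-defined bounded operator on $X$ (where $(1+\mathcal D^2)^{-1/2}$ is the positive bounded operator whose square is the inverse of $1+\mathcal D^2$), and $(X,V)$ is an odd Kasparov $A$-$F$-module: $X$ is countably generated, $A$ acts on $X$ through a $*$-homomorphism to the adjointable operators, $V$ is adjointable, and for every $a\in A$ the operators $a(V-V^*)$, $a(V^2-1)$ and $[V,a]$ are compact endomorphisms of $X$, i.e. lie in the norm closure of the linear span of the operators $\Theta_{x,y}z=x(y|z)$. Consequently $(X,V)$ defines an element of $KK^1(A,F)$, the homotopy classes of odd Kasparov $A$-$F$-modules. -/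

import Mathlib

universe u v w

namespace GraphKK

open UniformSpace
open scoped ENNReal

/-! ### Right Hilbert modules over a (possibly non-unital) C⋆-algebra -/

/-- A right pre-Hilbert module over the C⋆-algebra `B`: a right `B`-module `M` with a `B`-valued
positive semidefinite inner product, linear in the second variable.  In a C⋆-algebra the positive
elements are exactly those of the form `b⋆ b`. -/
class PreHilbertModule (B : Type v) [NonUnitalCStarAlgebra B] (M : Type w) [AddCommGroup M]
    [Module ℂ M] extends Inner B M where
  /-- the right action `x · b` -/
  ract : M → B → M
  ract_add_left : ∀ x y b, ract (x + y) b = ract x b + ract y b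
  ract_add_right : ∀ x b c, ract x (b + c) = ract x b + ract x c
  ract_mul : ∀ x b c, ract x (b * c) = ract (ract x b) c
  ract_smul_left : ∀ (z : ℂ) x b, ract (z • x) b = z • ract x b
  ract_smul_right : ∀ (z : ℂ) x b, ract x (z • b) = z • ract x b
  inner_add_right : ∀ x y z : M, inner x (y + z) = inner x y + inner x z
  inner_smul_right : ∀ (c : ℂ) (x y : M), inner x (c • y) = c • inner x y
  inner_ract_right : ∀ (x y : M) (b : B), inner x (ract y b) = inner x y * b
  star_inner : ∀ x y : M, star (inner x y) = inner y x
  inner_self_nonneg : ∀ x : M, ∃ b : B, inner x x = star b * b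

/-- A right Hilbert module over the C⋆-algebra `B` (a right `C⋆`-`B`-module): a right
pre-Hilbert module which is complete in the norm `‖x‖² = ‖⟨x, x⟩‖`. -/
class HilbertModule (B : Type v) [NonUnitalCStarAlgebra B] (X : Type w) [NormedAddCommGroup X]
    [NormedSpace ℂ X] extends PreHilbertModule B X where
  complete : CompleteSpace X
  norm_sq_eq : ∀ x : X, ‖x‖ ^ 2 = ‖inner x x‖

section PreHilbert

variable {B : Type v} [NonUnitalCStarAlgebra B] {M : Type w} [AddCommGroup M] [Module ℂ M]
  [PreHilbertModule B M]

namespace PreHilbertModule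

lemma inner_add_left (x y z : M) : inner B (x + y) z = inner B x z + inner B y z := by
  rw [← star_inner z, inner_add_right, star_add, star_inner, star_inner]

lemma inner_smul_left (c : ℂ) (x y : M) : inner B (c • x) y = star c • inner B x y := by
  rw [← star_inner y, inner_smul_right, star_smul, star_inner]

lemma inner_ract_left (x y : M) (b : B) : inner B (ract x b) y = star b * inner B x y := by
  rw [← star_inner y, inner_ract_right, star_mul, star_inner]

lemma inner_zero_right (x : M) : inner B x (0 : M) = 0 := by
  simpa using inner_smul_right (B := B) 0 x 0

lemma inner_neg_right (x y : M) : inner B x (-y) = - inner B x y := by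
  simpa using inner_smul_right (B := B) (-1) x y

lemma inner_sub_right (x y z : M) : inner B x (y - z) = inner B x y - inner B x z := by
  rw [sub_eq_add_neg, inner_add_right, inner_neg_right, ← sub_eq_add_neg]

lemma inner_sub_left (x y z : M) : inner B (x - y) z = inner B x z - inner B y z := by
  rw [← star_inner z, inner_sub_right, star_sub, star_inner, star_inner]

attribute [local instance] CStarAlgebra.spectralOrder CStarAlgebra.spectralOrderedRing

lemma inner_self_nonneg' (x : M) : 0 ≤ inner B x x := by
  obtain ⟨b, hb⟩ := inner_self_nonneg (B := B) x
  exact hb ▸ star_mul_self_nonneg b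

/-- The Cauchy–Schwarz inequality. -/
lemma norm_inner_sq_le (x y : M) :
    ‖inner B x y‖ ^ 2 ≤ ‖inner B x x‖ * ‖inner B y y‖ := by
  set p := ‖inner B x x‖ with hp
  have key : ∀ c : ℝ, 0 < c → p ≤ c → ‖inner B x y‖ ^ 2 ≤ c * ‖inner B y y‖ := by
    intro c hc hpc
    set t := inner B x y with ht
    have hyx : inner B y x = star t := (star_inner x y).symm
    have h1 : (0 : B) ≤ inner B (ract x t - (c : ℂ) • y) (ract x t - (c : ℂ) • y) :=
      inner_self_nonneg' _
    have h2 : inner B (ract x t - (c : ℂ) • y) (ract x t - (c : ℂ) • y)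
        = star t * inner B x x * t - (c : ℂ) • (star t * t) - (c : ℂ) • (star t * t)
          + (c : ℂ) • (c : ℂ) • inner B y y := by
      simp only [inner_sub_right, inner_sub_left, inner_ract_left, inner_ract_right,
        inner_smul_left, inner_smul_right, hyx, ← ht, smul_sub]
      simp only [RCLike.star_def, Complex.conj_ofReal, sub_mul, smul_mul_assoc, mul_assoc]
      abel
    have h3 : star t * inner B x x * t ≤ p • (star t * t) :=
      CStarAlgebra.star_left_conjugate_le_norm_smul (.of_nonneg (inner_self_nonneg' x))
    have h4 : p • (star t * t) ≤ c • (star t * t) :=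
      smul_le_smul_of_nonneg_right hpc (star_mul_self_nonneg t)
    have h5 : c • (star t * t) ≤ c • (c • inner B y y) := by
      rw [h2] at h1
      have h6 := h3.trans h4
      simp only [Complex.coe_smul] at h1
      rw [← sub_nonneg]
      have h7 := add_nonneg h1 (sub_nonneg.2 h6)
      convert h7 using 1
      abel
    have h8 : star t * t ≤ c • inner B y y := (smul_le_smul_iff_of_pos_left hc).1 h5
    calc ‖t‖ ^ 2 = ‖star t * t‖ := by rw [CStarRing.norm_star_mul_self, pow_two]
      _ ≤ ‖c • inner B y y‖ :=
        CStarAlgebra.norm_le_norm_of_nonneg_of_le (star_mul_self_nonneg t) h8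
      _ = c * ‖inner B y y‖ := by rw [norm_smul, Real.norm_of_nonneg hc.le]
  refine le_of_forall_pos_le_add fun ε hε => ?_
  have hd : 0 < ε / (‖inner B y y‖ + 1) := by positivity
  refine (key (p + ε / (‖inner B y y‖ + 1)) (by positivity) (by linarith)).trans ?_
  rw [add_mul]
  gcongr
  rw [div_mul_eq_mul_div, div_le_iff₀ (by positivity)]
  nlinarith [norm_nonneg (inner B y y)]

/-- `M` regarded as a seminormed space through `‖x‖ = ‖⟨x, x⟩‖^{1/2}`. -/
def Pre (B : Type v) [NonUnitalCStarAlgebra B] (M : Type w) [AddCommGroup M] [Module ℂ M]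
    [PreHilbertModule B M] : Type w := M

instance : AddCommGroup (Pre B M) := inferInstanceAs (AddCommGroup M)
instance : Module ℂ (Pre B M) := inferInstanceAs (Module ℂ M)
instance : PreHilbertModule B (Pre B M) := inferInstanceAs (PreHilbertModule B M)

/-- The identity map from `M` to `Pre B M`. -/
def Pre.of : M ≃ₗ[ℂ] Pre B M := LinearEquiv.refl ℂ M

lemma Pre.inner_of (x y : M) : inner B (Pre.of x : Pre B M) (Pre.of y) = inner B x y := rfl

noncomputable instance : Norm (Pre B M) := ⟨fun x => √‖inner B x x‖⟩

lemma pre_norm_def (x : Pre B M) : ‖x‖ = √‖inner B x x‖ := rfl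

lemma pre_norm_sq (x : Pre B M) : ‖x‖ ^ 2 = ‖inner B x x‖ := by
  rw [pre_norm_def, Real.sq_sqrt (norm_nonneg _)]

lemma pre_norm_nonneg (x : Pre B M) : 0 ≤ ‖x‖ := Real.sqrt_nonneg _

lemma pre_norm_inner_le (x y : Pre B M) : ‖inner B x y‖ ≤ ‖x‖ * ‖y‖ := by
  refine abs_le_of_sq_le_sq' ?_ (mul_nonneg (pre_norm_nonneg x) (pre_norm_nonneg y)) |>.2
  rw [mul_pow, pre_norm_sq, pre_norm_sq]
  exact norm_inner_sq_le x y

lemma pre_core : SeminormedSpace.Core ℂ (Pre B M) where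
  norm_nonneg := pre_norm_nonneg
  norm_smul c x := by
    rw [pre_norm_def, inner_smul_right, inner_smul_left, norm_smul, norm_smul, ← mul_assoc,
      norm_star, Real.sqrt_mul (by positivity), Real.sqrt_mul_self (norm_nonneg _), pre_norm_def]
  norm_triangle x y := by
    refine abs_le_of_sq_le_sq' ?_ (add_nonneg (pre_norm_nonneg x) (pre_norm_nonneg y)) |>.2
    have h1 := pre_norm_inner_le x y
    have h2 := pre_norm_inner_le y x
    have h3 : ‖inner B (x + y) (x + y)‖ ≤
        ‖inner B x x‖ + ‖inner B x y‖ + (‖inner B y x‖ + ‖inner B y y‖) := by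
      rw [inner_add_left, inner_add_right, inner_add_right]
      exact (norm_add_le _ _).trans (add_le_add (norm_add_le _ _) (norm_add_le _ _))
    rw [← pre_norm_sq, ← pre_norm_sq, ← pre_norm_sq] at h3
    nlinarith

noncomputable instance : SeminormedAddCommGroup (Pre B M) := .ofCore pre_core
noncomputable instance : NormedSpace ℂ (Pre B M) where
  norm_smul_le c x := (pre_core.norm_smul c x).le

lemma pre_continuous_inner :
    Continuous (Function.uncurry (inner B : Pre B M → Pre B M → B)) := by
  let f : Pre B M →ₗ⋆[ℂ] Pre B M →ₗ[ℂ] B :=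
    LinearMap.mk₂'ₛₗ (starRingEnd ℂ) (RingHom.id ℂ) (fun x y => inner B x y)
      inner_add_left inner_smul_left inner_add_right inner_smul_right
  let g := (f.mkContinuous₂ 1 (fun x y => by simpa [f] using pre_norm_inner_le x y))
  change Continuous fun p : Pre B M × Pre B M => g p.1 p.2
  fun_prop

lemma pre_norm_ract_le (x : Pre B M) (b : B) : ‖ract x b‖ ≤ ‖b‖ * ‖x‖ := by
  refine abs_le_of_sq_le_sq' ?_ (mul_nonneg (norm_nonneg _) (pre_norm_nonneg x)) |>.2
  rw [pre_norm_sq, inner_ract_left, inner_ract_right, mul_pow, pre_norm_sq]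
  calc _ ≤ ‖star b‖ * (‖inner B x x‖ * ‖b‖) :=
        (norm_mul_le _ _).trans (by gcongr; exact norm_mul_le _ _)
    _ = _ := by rw [norm_star]; ring

end PreHilbertModule

end PreHilbert

/-- The extension of a bounded linear operator to the completions. -/
noncomputable def complMap {M N : Type*} [SeminormedAddCommGroup M] [NormedSpace ℂ M]
    [SeminormedAddCommGroup N] [NormedSpace ℂ N] (T : M →L[ℂ] N) :
    Completion M →L[ℂ] Completion N :=
  ((Completion.toComplL : N →L[ℂ] Completion N).comp T).extend
    (Completion.toComplL : M →L[ℂ] Completion M)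

lemma complMap_coe {M N : Type*} [SeminormedAddCommGroup M] [NormedSpace ℂ M]
    [SeminormedAddCommGroup N] [NormedSpace ℂ N] (T : M →L[ℂ] N) (x : M) :
    complMap T (x : Completion M) = (T x : Completion N) :=
  ContinuousLinearMap.extend_eq _ Completion.denseRange_coe
    (Completion.isUniformInducing_coe M) x

section Completion

open PreHilbertModule

variable (B : Type v) [NonUnitalCStarAlgebra B] (M : Type w) [AddCommGroup M] [Module ℂ M]
  [PreHilbertModule B M]

/-- The Hilbert `B`-module obtained by completing a pre-Hilbert `B`-module `M` in the norm
`‖x‖ = ‖⟨x, x⟩‖^{1/2}`. -/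
abbrev HilbertCompletion : Type w := Completion (Pre B M)

variable {B M}

/-- Right multiplication by `b`, as a bounded operator. -/
noncomputable def ractCLM (b : B) : Pre B M →L[ℂ] Pre B M :=
  LinearMap.mkContinuous
    { toFun := fun x => ract x b
      map_add' := fun x y => ract_add_left x y b
      map_smul' := fun c x => ract_smul_left c x b } ‖b‖ (fun x => pre_norm_ract_le x b)

lemma compl_inner_coe (x y : Pre B M) :
    inner B (x : HilbertCompletion B M) (y : HilbertCompletion B M) = inner B x y :=
  (Completion.isDenseInducing_coe.prodMap Completion.isDenseInducing_coe).extend_eq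
    pre_continuous_inner (x, y)

lemma compl_continuous_inner :
    Continuous (Function.uncurry (inner B (E := HilbertCompletion B M))) := by
  let inner' : Pre B M →+ Pre B M →+ B :=
    AddMonoidHom.mk' (fun x => AddMonoidHom.mk' (fun y => inner B x y) (inner_add_right x))
      (fun x y => by ext z; exact inner_add_left x y z)
  have : Continuous fun p : Pre B M × Pre B M => inner' p.1 p.2 := pre_continuous_inner
  exact (Completion.isDenseInducing_toCompl (Pre B M)).extend_Z_bilin
    (Completion.isDenseInducing_toCompl (Pre B M)) this

lemma Continuous.compl_inner {α : Type*} [TopologicalSpace α] {f g : α → HilbertCompletion B M}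
    (hf : Continuous f) (hg : Continuous g) : Continuous (fun x => inner B (f x) (g x)) :=
  compl_continuous_inner.comp (hf.prodMk hg)

section

attribute [local instance] CStarAlgebra.spectralOrder CStarAlgebra.spectralOrderedRing

lemma exists_eq_star_mul_self_iff (b : B) : (∃ c, b = star c * c) ↔ 0 ≤ b := by
  constructor
  · rintro ⟨c, rfl⟩
    exact star_mul_self_nonneg c
  · intro h
    exact CStarAlgebra.nonneg_iff_eq_star_mul_self.1 h

lemma isClosed_pos : IsClosed {b : B | ∃ c, b = star c * c} := by
  simp only [exists_eq_star_mul_self_iff]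
  exact CStarAlgebra.isClosed_nonneg

end

lemma compl_inner_add_right (x y z : HilbertCompletion B M) :
    inner B x (y + z) = inner B x y + inner B x z := by
  refine Completion.induction_on₃ x y z (isClosed_eq ?_ ?_) fun a b c => ?_
  · exact Continuous.compl_inner continuous_fst (continuous_snd.fst.add continuous_snd.snd)
  · exact (Continuous.compl_inner continuous_fst continuous_snd.fst).add
      (Continuous.compl_inner continuous_fst continuous_snd.snd)
  · rw [← Completion.coe_add, compl_inner_coe, compl_inner_coe, compl_inner_coe,
      PreHilbertModule.inner_add_right]

lemma compl_inner_smul_right (c : ℂ) (x y : HilbertCompletion B M) :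
    inner B x (c • y) = c • inner B x y := by
  have h1 : Continuous fun p : HilbertCompletion B M × HilbertCompletion B M =>
      inner B p.1 (c • p.2) :=
    Continuous.compl_inner continuous_fst
      ((continuous_const_smul c : Continuous fun y : HilbertCompletion B M => c • y).comp
        continuous_snd)
  have h2 : Continuous fun p : HilbertCompletion B M × HilbertCompletion B M =>
      c • inner B p.1 p.2 :=
    (continuous_const_smul c : Continuous fun b : B => c • b).comp
      (Continuous.compl_inner continuous_fst continuous_snd)
  refine Completion.induction_on₂ x y (isClosed_eq h1 h2) fun a b => ?_
  rw [← Completion.coe_smul, compl_inner_coe, compl_inner_coe, PreHilbertModule.inner_smul_right]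

lemma compl_inner_ract_right (x y : HilbertCompletion B M) (b : B) :
    inner B x (complMap (ractCLM b) y) = inner B x y * b := by
  refine Completion.induction_on₂ x y (isClosed_eq ?_ ?_) fun a c => ?_
  · exact Continuous.compl_inner continuous_fst
      ((complMap (ractCLM b)).continuous.comp continuous_snd)
  · exact (Continuous.compl_inner continuous_fst continuous_snd).mul continuous_const
  · rw [complMap_coe, compl_inner_coe, compl_inner_coe]
    exact inner_ract_right a c b

lemma compl_star_inner (x y : HilbertCompletion B M) : star (inner B x y) = inner B y x := by
  refine Completion.induction_on₂ x y (isClosed_eq ?_ ?_) fun a b => ?_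
  · exact (Continuous.compl_inner continuous_fst continuous_snd).star
  · exact Continuous.compl_inner continuous_snd continuous_fst
  · rw [compl_inner_coe, compl_inner_coe, star_inner]

lemma compl_inner_self_nonneg (x : HilbertCompletion B M) : ∃ b : B, inner B x x = star b * b := by
  refine Completion.induction_on x ?_ fun a => ?_
  · exact isClosed_pos.preimage (Continuous.compl_inner continuous_id continuous_id)
  · rw [compl_inner_coe]
    exact inner_self_nonneg a

lemma compl_norm_sq_eq (x : HilbertCompletion B M) : ‖x‖ ^ 2 = ‖inner B x x‖ := by
  refine Completion.induction_on x (isClosed_eq (continuous_norm.pow 2) ?_) fun a => ?_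
  · exact (Continuous.compl_inner continuous_id continuous_id).norm
  · rw [compl_inner_coe, Completion.norm_coe, pre_norm_sq]

lemma compl_ract_add_right (x : HilbertCompletion B M) (b c : B) :
    complMap (ractCLM (b + c)) x = complMap (ractCLM b) x + complMap (ractCLM c) x := by
  refine Completion.induction_on x (isClosed_eq (ContinuousLinearMap.continuous _)
    ((ContinuousLinearMap.continuous _).add (ContinuousLinearMap.continuous _))) fun a => ?_
  rw [complMap_coe, complMap_coe, complMap_coe, ← Completion.coe_add]
  exact congrArg _ (ract_add_right (M := M) a b c)

lemma compl_ract_mul (x : HilbertCompletion B M) (b c : B) :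
    complMap (ractCLM (b * c)) x = complMap (ractCLM c) (complMap (ractCLM b) x) := by
  refine Completion.induction_on x (isClosed_eq (ContinuousLinearMap.continuous _)
    ((ContinuousLinearMap.continuous _).comp (ContinuousLinearMap.continuous _))) fun a => ?_
  rw [complMap_coe, complMap_coe, complMap_coe]
  exact congrArg _ (ract_mul (M := M) a b c)

lemma compl_ract_smul_right (z : ℂ) (x : HilbertCompletion B M) (b : B) :
    complMap (ractCLM (z • b)) x = z • complMap (ractCLM b) x := by
  refine Completion.induction_on x (isClosed_eq (ContinuousLinearMap.continuous _)
    (z • complMap (ractCLM b)).continuous) fun a => ?_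
  rw [complMap_coe, complMap_coe, ← Completion.coe_smul]
  exact congrArg _ (ract_smul_right (M := M) z a b)

noncomputable instance instHilbertCompletion : HilbertModule B (HilbertCompletion B M) where
  ract x b := complMap (ractCLM b) x
  ract_add_left x y _ := map_add _ x y
  ract_add_right := compl_ract_add_right
  ract_mul := compl_ract_mul
  ract_smul_left z x _ := map_smul _ z x
  ract_smul_right := compl_ract_smul_right
  inner_add_right := compl_inner_add_right
  inner_smul_right := compl_inner_smul_right
  inner_ract_right := compl_inner_ract_right
  star_inner := compl_star_inner
  inner_self_nonneg := compl_inner_self_nonneg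
  complete := inferInstance
  norm_sq_eq := compl_norm_sq_eq

end Completion

/-! ### Operators of the form `∑ k P_k` -/

section Diagonal

variable (B : Type v) [NonUnitalCStarAlgebra B] {Y : Type w} [NormedAddCommGroup Y]
  [NormedSpace ℂ Y] [HilbertModule B Y]

section

attribute [local instance] CStarAlgebra.spectralOrder CStarAlgebra.spectralOrderedRing

variable {B} in
lemma summable_of_nonneg_of_le {ι : Type*} {f g : ι → B}
    (hf : ∀ i, 0 ≤ f i) (hfg : ∀ i, f i ≤ g i) (hg : Summable g) : Summable f := by
  rw [summable_iff_vanishing_norm] at hg ⊢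
  intro ε hε
  obtain ⟨s, hs⟩ := hg ε hε
  refine ⟨s, fun t ht => lt_of_le_of_lt ?_ (hs t ht)⟩
  exact CStarAlgebra.norm_le_norm_of_nonneg_of_le (Finset.sum_nonneg fun i _ => hf i)
    (Finset.sum_le_sum fun i _ => hfg i)

lemma inner_add_self_le (x y : Y) :
    inner B (x + y) (x + y) ≤ (2 : ℝ) • inner B x x + (2 : ℝ) • inner B y y := by
  have h := PreHilbertModule.inner_self_nonneg' (B := B) (x - y)
  rw [← sub_nonneg]
  convert h using 1
  simp only [PreHilbertModule.inner_sub_left, PreHilbertModule.inner_sub_right,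
    PreHilbertModule.inner_add_left, PreHilbertModule.inner_add_right, two_smul]
  abel

lemma summable_weighted_add {P : ℤ → Y →ₗ[ℂ] Y} {x y : Y}
    (hx : Summable fun k : ℤ => ((k : ℝ) ^ 2) • inner B (P k x) (P k x))
    (hy : Summable fun k : ℤ => ((k : ℝ) ^ 2) • inner B (P k y) (P k y)) :
    Summable fun k : ℤ => ((k : ℝ) ^ 2) • inner B (P k (x + y)) (P k (x + y)) := by
  refine summable_of_nonneg_of_le (fun k => ?_) (fun k => ?_)
    ((hx.const_smul (2 : ℝ)).add (hy.const_smul (2 : ℝ)))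
  · exact smul_nonneg (by positivity) (PreHilbertModule.inner_self_nonneg' _)
  · rw [map_add, smul_comm (2 : ℝ), smul_comm (2 : ℝ), ← smul_add]
    exact smul_le_smul_of_nonneg_left (inner_add_self_le B _ _) (by positivity)

end

/-- The subspace of all `x` for which `∑ k² (x_k|x_k)`, with `x_k = P_k x`, converges. -/
def weightedDomain (P : ℤ → Y →ₗ[ℂ] Y) : Submodule ℂ Y where
  carrier := {x | Summable fun k : ℤ => ((k : ℝ) ^ 2) • inner B (P k x) (P k x)}
  add_mem' hx hy := summable_weighted_add B hx hy
  zero_mem' := by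
    have h : (fun k : ℤ => ((k : ℝ) ^ 2) • inner B (P k 0) (P k 0)) = fun _ => 0 := by
      funext k
      rw [map_zero, PreHilbertModule.inner_zero_right, smul_zero]
    change Summable _
    rw [h]
    exact summable_zero
  smul_mem' c x hx := by
    have hx' : Summable fun k : ℤ => ((k : ℝ) ^ 2) • inner B (P k x) (P k x) := hx
    change Summable _
    convert (hx'.const_smul (star c * c)) using 2 with k
    rw [map_smul, PreHilbertModule.inner_smul_left, PreHilbertModule.inner_smul_right,
      smul_smul (star c), smul_comm]

variable {B} in
lemma mem_weightedDomain {P : ℤ → Y →ₗ[ℂ] Y} {x : Y} : x ∈ weightedDomain B P ↔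
    Summable fun k : ℤ => ((k : ℝ) ^ 2) • inner B (P k x) (P k x) := Iff.rfl

lemma inner_sum_sum {f : ℤ → Y} (hf : ∀ k l, k ≠ l → inner B (f k) (f l) = 0) (s : Finset ℤ) :
    inner B (∑ k ∈ s, f k) (∑ k ∈ s, f k) = ∑ k ∈ s, inner B (f k) (f k) := by
  have hl : ∀ y, inner B (∑ k ∈ s, f k) y = ∑ k ∈ s, inner B (f k) y := fun y =>
    map_sum (AddMonoidHom.mk' (fun x => inner B x y)
      (fun a b => PreHilbertModule.inner_add_left a b y)) f s
  have hr : ∀ x, inner B x (∑ k ∈ s, f k) = ∑ k ∈ s, inner B x (f k) := fun x =>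
    map_sum (AddMonoidHom.mk' (fun y => inner B x y)
      (fun a b => PreHilbertModule.inner_add_right x a b)) f s
  rw [hl]
  refine Finset.sum_congr rfl fun k hk => ?_
  rw [hr, Finset.sum_eq_single k (fun l _ h => hf k l h.symm) (fun h => (h hk).elim)]

variable {B} in
lemma summable_of_mem_weightedDomain {P : ℤ → Y →ₗ[ℂ] Y}
    (hP : ∀ k l, k ≠ l → ∀ x y, inner B (P k x) (P l y) = 0) {x : Y}
    (hx : x ∈ weightedDomain B P) : Summable fun k : ℤ => (k : ℂ) • P k x := by
  have := HilbertModule.complete B (X := Y)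
  rw [mem_weightedDomain, summable_iff_vanishing_norm] at hx
  rw [summable_iff_vanishing_norm]
  intro ε hε
  obtain ⟨s, hs⟩ := hx (ε ^ 2) (by positivity)
  refine ⟨s, fun t ht => lt_of_pow_lt_pow_left₀ 2 hε.le ?_⟩
  refine lt_of_eq_of_lt ?_ (hs t ht)
  rw [HilbertModule.norm_sq_eq (B := B), inner_sum_sum]
  · congr 1
    refine Finset.sum_congr rfl fun k _ => ?_
    rw [PreHilbertModule.inner_smul_left, PreHilbertModule.inner_smul_right, smul_smul,
      ← Complex.coe_smul]
    congr 1
    simp [pow_two]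
  · intro k l hkl
    rw [PreHilbertModule.inner_smul_left, PreHilbertModule.inner_smul_right, hP k l hkl,
      smul_zero, smul_zero]

/-- For mutually orthogonal `P_k` the operator `x ↦ ∑ k P_k x`, with the domain of all `x` for
which `∑ k² (P_k x|P_k x)` converges. -/
noncomputable def weightedSum (P : ℤ → Y →ₗ[ℂ] Y)
    (hP : ∀ k l, k ≠ l → ∀ x y, inner B (P k x) (P l y) = 0) : Y →ₗ.[ℂ] Y where
  domain := weightedDomain B P
  toFun :=
    { toFun := fun x => ∑' k : ℤ, (k : ℂ) • P k (x : Y)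
      map_add' := fun x y => by
        rw [← (summable_of_mem_weightedDomain hP x.2).tsum_add
          (summable_of_mem_weightedDomain hP y.2)]
        refine tsum_congr fun k => ?_
        rw [Submodule.coe_add, map_add, smul_add]
      map_smul' := fun c x => by
        rw [RingHom.id_apply, ← (summable_of_mem_weightedDomain hP x.2).tsum_const_smul c]
        refine tsum_congr fun k => ?_
        rw [Submodule.coe_smul, map_smul, smul_comm] }

end Diagonal

/-! ### Circle actions, the conditional expectation and the associated Hilbert module -/

/-- A strongly continuous action of the circle group on a C⋆-algebra by ⋆-automorphisms. -/
structure CircleAction (A : Type v) [NonUnitalCStarAlgebra A] where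
  /-- the automorphism belonging to `z` -/
  act : Circle → (A →⋆ₙₐ[ℂ] A)
  act_one : ∀ a, act 1 a = a
  act_mul : ∀ z w a, act (z * w) a = act z (act w a)
  continuous_act : ∀ a, Continuous fun z => act z a

namespace CircleAction

variable {A : Type v} [NonUnitalCStarAlgebra A] (α : CircleAction A)

lemma act_inv_act (z : Circle) (a : A) : α.act z⁻¹ (α.act z a) = a := by
  rw [← α.act_mul, inv_mul_cancel, α.act_one]

lemma act_act_inv (z : Circle) (a : A) : α.act z (α.act z⁻¹ a) = a := by
  rw [← α.act_mul, mul_inv_cancel, α.act_one]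

lemma norm_act (z : Circle) (a : A) : ‖α.act z a‖ = ‖a‖ :=
  NonUnitalStarAlgHom.norm_map (α.act z) (Function.LeftInverse.injective (α.act_inv_act z)) a

/-- The automorphism belonging to `z`, as a bounded linear map. -/
noncomputable def actCLM (z : Circle) : A →L[ℂ] A :=
  LinearMap.mkContinuous
    { toFun := α.act z, map_add' := map_add (α.act z), map_smul' := map_smul (α.act z) } 1
    (fun a => by simpa using (α.norm_act z a).le)

/-- The fixed point algebra of the action. -/
def fixed : NonUnitalStarSubalgebra ℂ A where
  carrier := {a | ∀ z, α.act z a = a}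
  add_mem' ha hb z := by rw [map_add, ha, hb]
  zero_mem' z := map_zero _
  mul_mem' ha hb z := by rw [map_mul, ha, hb]
  smul_mem' c a ha z := by rw [map_smul, ha]
  star_mem' ha z := by rw [map_star, ha]

lemma mem_fixed {a : A} : a ∈ α.fixed ↔ ∀ z, α.act z a = a := Iff.rfl

instance isClosed_fixed : IsClosed (α.fixed : Set A) := by
  have : (α.fixed : Set A) = ⋂ z, {a | α.actCLM z a = a} := by
    ext a
    simp only [Set.mem_iInter]
    rfl
  rw [this]
  exact isClosed_iInter fun z => isClosed_eq (α.actCLM z).continuous continuous_id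

lemma continuous_act_exp (a : A) : Continuous fun θ : ℝ => α.act (Circle.exp θ) a :=
  (α.continuous_act a).comp Circle.exp.continuous

/-- The average `(1/2π) ∫ α_z(a) dθ`, `z = e^{iθ}`. -/
noncomputable def average (a : A) : A :=
  (2 * Real.pi)⁻¹ • ∫ θ in (0 : ℝ)..2 * Real.pi, α.act (Circle.exp θ) a

lemma act_average (w : Circle) (a : A) : α.act w (α.average a) = α.average a := by
  obtain ⟨t, rfl⟩ : ∃ t, Circle.exp t = w := ⟨Complex.arg w, Circle.exp_arg w⟩
  have h1 : α.act (Circle.exp t) (α.average a) = (2 * Real.pi)⁻¹ •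
      ∫ θ in (0 : ℝ)..2 * Real.pi, α.act (Circle.exp t) (α.act (Circle.exp θ) a) := by
    change α.actCLM (Circle.exp t) (α.average a) = _
    rw [average, ← Complex.coe_smul, map_smul, Complex.coe_smul]
    congr 1
    exact (ContinuousLinearMap.intervalIntegral_comp_comm _
      ((α.continuous_act_exp a).intervalIntegrable _ _)).symm
  rw [h1, average]
  congr 1
  have h2 : (fun θ : ℝ => α.act (Circle.exp t) (α.act (Circle.exp θ) a))
      = fun θ => (fun s => α.act (Circle.exp s) a) (θ + t) := by
    ext θ
    rw [← α.act_mul, ← Circle.exp_add, add_comm]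
  rw [h2, intervalIntegral.integral_comp_add_right (fun s => α.act (Circle.exp s) a)]
  have hper : Function.Periodic (fun s => α.act (Circle.exp s) a) (2 * Real.pi) := fun s => by
    simp only [Circle.exp_add, Circle.exp_two_pi, mul_one]
  have := hper.intervalIntegral_add_eq t 0
  rw [zero_add] at this
  rw [zero_add, add_comm (2 * Real.pi) t, this]

/-- The conditional expectation `Φ` onto the fixed point algebra. -/
noncomputable def expectation (a : A) : α.fixed := ⟨α.average a, fun z => α.act_average z a⟩

lemma average_add (a b : A) : α.average (a + b) = α.average a + α.average b := by
  simp only [average, map_add]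
  rw [intervalIntegral.integral_add ((α.continuous_act_exp a).intervalIntegrable _ _)
    ((α.continuous_act_exp b).intervalIntegrable _ _), smul_add]

lemma average_smul (c : ℂ) (a : A) : α.average (c • a) = c • α.average a := by
  simp only [average, map_smul]
  rw [intervalIntegral.integral_smul, smul_comm]

lemma average_mul_fixed (a : A) (b : α.fixed) : α.average (a * b) = α.average a * b := by
  have h : ∀ z, α.act z (b : A) = b := b.2
  simp only [average, map_mul, h]
  rw [smul_mul_assoc]
  congr 1
  exact ContinuousLinearMap.intervalIntegral_comp_comm ((ContinuousLinearMap.mul ℂ A).flip (b : A))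
    ((α.continuous_act_exp a).intervalIntegrable _ _)

lemma average_star (a : A) : α.average (star a) = star (α.average a) := by
  simp only [average, map_star, star_smul, star_trivial]
  congr 1
  exact ContinuousLinearMap.intervalIntegral_comp_comm
    ((starL' ℝ : A ≃L[ℝ] A) : A →L[ℝ] A) ((α.continuous_act_exp a).intervalIntegrable _ _)

lemma average_act (w : Circle) (a : A) : α.average (α.act w a) = α.average a := by
  obtain ⟨t, rfl⟩ : ∃ t, Circle.exp t = w := ⟨Complex.arg w, Circle.exp_arg w⟩
  rw [← α.act_average (Circle.exp t) a]
  change _ = α.actCLM (Circle.exp t) (α.average a)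
  rw [average, average, ← Complex.coe_smul, ← Complex.coe_smul, map_smul]
  congr 1
  rw [← ContinuousLinearMap.intervalIntegral_comp_comm _
      ((α.continuous_act_exp a).intervalIntegrable _ _)]
  congr 1
  ext θ
  change _ = α.act _ _
  rw [← α.act_mul, ← α.act_mul, mul_comm]

section

attribute [local instance] CStarAlgebra.spectralOrder CStarAlgebra.spectralOrderedRing

lemma average_nonneg {a : A} (ha : 0 ≤ a) : 0 ≤ α.average a := by
  refine smul_nonneg (by positivity) ?_
  rw [intervalIntegral.integral_of_le (by positivity)]
  refine MeasureTheory.integral_nonneg fun θ => ?_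
  obtain ⟨c, rfl⟩ := (exists_eq_star_mul_self_iff a).2 ha
  simp only [map_mul, map_star, Pi.zero_apply]
  exact star_mul_self_nonneg _

lemma average_mono {a b : A} (h : a ≤ b) : α.average a ≤ α.average b := by
  have h1 := α.average_nonneg (sub_nonneg.2 h)
  have h2 := α.average_add (b - a) a
  rw [sub_add_cancel] at h2
  rw [h2]
  exact le_add_of_nonneg_left h1

/-- A positive element of the fixed point algebra has its square root there. -/
lemma exists_fixed_sqrt (a : α.fixed) (ha : 0 ≤ (a : A)) : ∃ b : α.fixed, a = star b * b := by
  have h0 : 0 ≤ CFC.sqrt (a : A) := CFC.sqrt_nonneg _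
  have h1 : CFC.sqrt (a : A) * CFC.sqrt (a : A) = a := CFC.sqrt_mul_sqrt_self _ ha
  have h2 : CFC.sqrt (a : A) ∈ α.fixed := by
    intro z
    symm
    refine CFC.sqrt_unique ?_ ?_
    · rw [← map_mul, h1, a.2 z]
    · obtain ⟨c, hc⟩ := (exists_eq_star_mul_self_iff _).2 h0
      rw [hc, map_mul, map_star]
      exact star_mul_self_nonneg _
  refine ⟨⟨_, h2⟩, Subtype.ext ?_⟩
  change (a : A) = star (CFC.sqrt (a : A)) * CFC.sqrt (a : A)
  rw [(IsSelfAdjoint.of_nonneg h0).star_eq, h1]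

end

/-- The algebra `A` as a right pre-Hilbert module over the fixed point algebra `F`: right
multiplication and the inner product `(a|b) = Φ(a⋆ b)`. -/
noncomputable instance : PreHilbertModule α.fixed A where
  ract a b := a * b
  inner a b := α.expectation (star a * b)
  ract_add_left _ _ _ := add_mul _ _ _
  ract_add_right _ _ _ := mul_add _ _ _
  ract_mul _ _ _ := (mul_assoc _ _ _).symm
  ract_smul_left _ _ _ := smul_mul_assoc _ _ _
  ract_smul_right _ _ _ := mul_smul_comm _ _ _
  inner_add_right x y z := Subtype.ext <| by
    simp only [mul_add]
    exact α.average_add _ _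
  inner_smul_right c x y := Subtype.ext <| by
    simp only [mul_smul_comm]
    exact α.average_smul _ _
  inner_ract_right x y b := Subtype.ext <| by
    simp only [← mul_assoc]
    exact α.average_mul_fixed _ b
  star_inner x y := Subtype.ext <| by
    change star (α.average _) = α.average _
    rw [← α.average_star, star_mul, star_star]
  inner_self_nonneg x := by
    let := CStarAlgebra.spectralOrder A
    have := CStarAlgebra.spectralOrderedRing A
    exact α.exists_fixed_sqrt _ (α.average_nonneg (star_mul_self_nonneg x))

open PreHilbertModule

lemma inner_def (a b : A) : ((inner α.fixed a b : α.fixed) : A) = α.average (star a * b) := rfl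

/-- The right Hilbert `F`-module `X`, the completion of `A` in the norm `‖Φ(x⋆ x)‖^{1/2}`. -/
abbrev X : Type v := HilbertCompletion α.fixed A

/-- The canonical map `A → X`. -/
noncomputable def toX (a : A) : α.X := ((Pre.of a : Pre α.fixed A) : Completion (Pre α.fixed A))

lemma norm_of_mul_le (a b : A) :
    ‖(Pre.of (a * b) : Pre α.fixed A)‖ ≤ ‖a‖ * ‖(Pre.of b : Pre α.fixed A)‖ := by
  let := CStarAlgebra.spectralOrder A
  have := CStarAlgebra.spectralOrderedRing A
  refine abs_le_of_sq_le_sq' ?_ (by positivity) |>.2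
  rw [mul_pow, pre_norm_sq, pre_norm_sq]
  change ‖α.average (star (a * b) * (a * b))‖ ≤ ‖a‖ ^ 2 * ‖α.average (star b * b)‖
  have h1 : star (a * b) * (a * b) ≤ ‖a‖ ^ 2 • (star b * b) := by
    have h2 := CStarAlgebra.star_left_conjugate_le_norm_smul (a := b) (b := star a * a)
      (.star_mul_self a)
    rw [CStarRing.norm_star_mul_self, ← pow_two] at h2
    simpa only [star_mul, mul_assoc] using h2
  have h3 := α.average_mono h1
  have h4 : α.average (‖a‖ ^ 2 • (star b * b)) = ‖a‖ ^ 2 • α.average (star b * b) := by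
    rw [← Complex.coe_smul, average_smul, Complex.coe_smul]
  rw [h4] at h3
  have h5 := CStarAlgebra.norm_le_norm_of_nonneg_of_le
    (α.average_nonneg (star_mul_self_nonneg (a * b))) h3
  rwa [norm_smul, Real.norm_of_nonneg (by positivity)] at h5

/-- Left multiplication by `a` on the dense subspace `A` of `X`. -/
noncomputable def preLeftMul (a : A) : Pre α.fixed A →L[ℂ] Pre α.fixed A :=
  LinearMap.mkContinuous (Pre.of.toLinearMap ∘ₗ LinearMap.mulLeft ℂ a ∘ₗ Pre.of.symm.toLinearMap)
    ‖a‖ (fun b => α.norm_of_mul_le a (Pre.of.symm b))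

lemma X_ext {S T : α.X →L[ℂ] α.X} (h : ∀ a : A, S (α.toX a) = T (α.toX a)) : S = T :=
  ContinuousLinearMap.ext fun x =>
    Completion.induction_on x (isClosed_eq S.continuous T.continuous) h

lemma toX_add (a b : A) : α.toX (a + b) = α.toX a + α.toX b := Completion.coe_add _ _

lemma toX_sub (a b : A) : α.toX (a - b) = α.toX a - α.toX b := Completion.coe_sub _ _

lemma toX_smul (c : ℂ) (a : A) : α.toX (c • a) = c • α.toX a := by
  rw [toX, map_smul, Completion.coe_smul, toX]

lemma complMap_preLeftMul (a b : A) : complMap (α.preLeftMul a) (α.toX b) = α.toX (a * b) :=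
  complMap_coe _ _

/-- The left action of `A` on `X` by multiplication. -/
noncomputable def leftMul : A →ₙₐ[ℂ] (α.X →L[ℂ] α.X) where
  toFun a := complMap (α.preLeftMul a)
  map_smul' c a := α.X_ext fun b => by
    change _ = c • complMap (α.preLeftMul a) (α.toX b)
    rw [complMap_preLeftMul, complMap_preLeftMul, smul_mul_assoc, toX_smul]
  map_zero' := α.X_ext fun b => by
    rw [complMap_preLeftMul, zero_mul]
    exact Completion.coe_zero
  map_add' a a' := α.X_ext fun b => by
    change _ = complMap (α.preLeftMul a) (α.toX b) + complMap (α.preLeftMul a') (α.toX b)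
    rw [complMap_preLeftMul, complMap_preLeftMul, complMap_preLeftMul, add_mul, toX_add]
  map_mul' a a' := α.X_ext fun b => by
    change _ = complMap (α.preLeftMul a) (complMap (α.preLeftMul a') (α.toX b))
    rw [complMap_preLeftMul, complMap_preLeftMul, complMap_preLeftMul, mul_assoc]

lemma inner_of_act (z : Circle) (a b : A) :
    inner α.fixed (Pre.of (α.act z a) : Pre α.fixed A) (Pre.of (α.act z b))
      = inner α.fixed (Pre.of a : Pre α.fixed A) (Pre.of b) := by
  refine Subtype.ext ?_
  change α.average (star (α.act z a) * α.act z b) = α.average (star a * b)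
  rw [← map_star, ← map_mul, average_act]

/-- The action of `z` on the dense subspace `A` of `X`. -/
noncomputable def preUnitary (z : Circle) : Pre α.fixed A →L[ℂ] Pre α.fixed A :=
  LinearMap.mkContinuous
    (Pre.of.toLinearMap ∘ₗ (α.actCLM z).toLinearMap ∘ₗ Pre.of.symm.toLinearMap) 1
    (fun b => by
      rw [one_mul, pre_norm_def, pre_norm_def]
      exact (congrArg (fun t => √‖t‖) (α.inner_of_act z (Pre.of.symm b) (Pre.of.symm b))).le)

/-- The unitary action of the circle on `X` which extends the action on `A`. -/
noncomputable def unitary (z : Circle) : α.X →L[ℂ] α.X := complMap (α.preUnitary z)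

lemma inner_unitary (z : Circle) (x y : α.X) :
    inner α.fixed (α.unitary z x) (α.unitary z y) = inner α.fixed x y := by
  refine Completion.induction_on₂ x y (isClosed_eq ?_ ?_) fun a b => ?_
  · exact Continuous.compl_inner ((α.unitary z).continuous.comp continuous_fst)
      ((α.unitary z).continuous.comp continuous_snd)
  · exact Continuous.compl_inner continuous_fst continuous_snd
  · rw [unitary, complMap_coe, complMap_coe, compl_inner_coe, compl_inner_coe]
    exact α.inner_of_act z (Pre.of.symm a) (Pre.of.symm b)

lemma norm_unitary (z : Circle) (x : α.X) : ‖α.unitary z x‖ = ‖x‖ := by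
  have h : ‖α.unitary z x‖ ^ 2 = ‖x‖ ^ 2 := by
    rw [compl_norm_sq_eq, compl_norm_sq_eq, inner_unitary]
  exact (pow_left_inj₀ (norm_nonneg _) (norm_nonneg _) two_ne_zero).1 h

lemma unitary_mul (z w : Circle) (x : α.X) :
    α.unitary (z * w) x = α.unitary z (α.unitary w x) := by
  refine Completion.induction_on x (isClosed_eq (ContinuousLinearMap.continuous _)
    ((ContinuousLinearMap.continuous _).comp (ContinuousLinearMap.continuous _))) fun a => ?_
  rw [unitary, unitary, unitary, complMap_coe, complMap_coe, complMap_coe]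
  exact congrArg _ (α.act_mul z w a)

lemma norm_average_le (a : A) : ‖α.average a‖ ≤ ‖a‖ := by
  have h : ‖∫ θ in (0 : ℝ)..2 * Real.pi, α.act (Circle.exp θ) a‖ ≤ ‖a‖ * |2 * Real.pi - 0| :=
    intervalIntegral.norm_integral_le_of_norm_le_const fun θ _ => (α.norm_act _ a).le
  rw [sub_zero, abs_of_pos Real.two_pi_pos] at h
  rw [average, norm_smul, norm_inv, Real.norm_of_nonneg Real.two_pi_pos.le,
    inv_mul_le_iff₀ Real.two_pi_pos]
  linarith

lemma norm_toX_le (a : A) : ‖α.toX a‖ ≤ ‖a‖ := by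
  refine abs_le_of_sq_le_sq' ?_ (norm_nonneg _) |>.2
  rw [toX, Completion.norm_coe, pre_norm_sq]
  refine (α.norm_average_le (star a * a)).trans ?_
  rw [CStarRing.norm_star_mul_self, pow_two]

lemma continuous_toX : Continuous α.toX := by
  have h : LipschitzWith 1 α.toX := LipschitzWith.of_dist_le_mul fun a b => by
    rw [NNReal.coe_one, one_mul, dist_eq_norm, dist_eq_norm]
    rw [← toX_sub]
    exact α.norm_toX_le _
  exact h.continuous

lemma continuous_unitary (x : α.X) : Continuous fun z => α.unitary z x := by
  refine Completion.induction_on (p := fun x : α.X => Continuous fun z => α.unitary z x) x ?_ ?_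
  · rw [← isSeqClosed_iff_isClosed]
    intro f y hf hy
    refine continuous_of_uniform_approx_of_continuous fun s hs => ?_
    obtain ⟨ε, hε, hεs⟩ := Metric.mem_uniformity_dist.1 hs
    obtain ⟨n, hn⟩ := ((Metric.tendsto_nhds.1 hy) ε hε).exists
    refine ⟨fun z => α.unitary z (f n), hf n, fun z => hεs ?_⟩
    rw [dist_comm, dist_eq_norm, ← map_sub, norm_unitary, ← dist_eq_norm]
    exact hn
  · intro a
    have : (fun z => α.unitary z (a : α.X)) = fun z => α.toX (α.act z a) := by
      ext z
      exact complMap_coe _ _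
    rw [this]
    exact α.continuous_toX.comp (α.continuous_act a)

lemma continuous_integrand (k : ℤ) (x : α.X) :
    Continuous fun θ : ℝ => ((Circle.exp θ : ℂ) ^ (-k)) • α.unitary (Circle.exp θ) x := by
  have h1 : Continuous fun θ : ℝ => ((Circle.exp θ : ℂ) ^ (-k)) :=
    (continuous_subtype_val.comp Circle.exp.continuous).zpow₀ _
      fun θ => Or.inl (Circle.coe_ne_zero _)
  exact h1.smul ((α.continuous_unitary x).comp Circle.exp.continuous)

/-- The projection `Φ_k(x) = (1/2π) ∫ z^{-k} U_z(x) dθ`, `z = e^{iθ}`, onto the `k`-th spectral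
subspace of the circle action on `X`. -/
noncomputable def spectralProj (k : ℤ) : α.X →ₗ[ℂ] α.X where
  toFun x := (2 * Real.pi)⁻¹ • ∫ θ in (0 : ℝ)..2 * Real.pi,
    ((Circle.exp θ : ℂ) ^ (-k)) • α.unitary (Circle.exp θ) x
  map_add' x y := by
    simp only [map_add, smul_add]
    rw [intervalIntegral.integral_add ((α.continuous_integrand k x).intervalIntegrable _ _)
      ((α.continuous_integrand k y).intervalIntegrable _ _), smul_add]
  map_smul' c x := by
    simp only [map_smul, RingHom.id_apply]
    rw [smul_comm c, ← intervalIntegral.integral_smul c]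
    congr 2
    funext θ
    rw [smul_comm]

lemma spectralProj_apply (k : ℤ) (x : α.X) : α.spectralProj k x =
    (2 * Real.pi)⁻¹ • ∫ θ in (0 : ℝ)..2 * Real.pi,
      ((Circle.exp θ : ℂ) ^ (-k)) • α.unitary (Circle.exp θ) x := rfl

lemma unitary_spectralProj (k : ℤ) (t : ℝ) (x : α.X) :
    α.unitary (Circle.exp t) (α.spectralProj k x)
      = ((Circle.exp t : ℂ) ^ k) • α.spectralProj k x := by
  have h1 : α.unitary (Circle.exp t) (α.spectralProj k x) = (2 * Real.pi)⁻¹ •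
      ∫ θ in (0 : ℝ)..2 * Real.pi, α.unitary (Circle.exp t)
        (((Circle.exp θ : ℂ) ^ (-k)) • α.unitary (Circle.exp θ) x) := by
    rw [spectralProj_apply, ← Complex.coe_smul, map_smul, Complex.coe_smul]
    congr 1
    exact (ContinuousLinearMap.intervalIntegral_comp_comm _
      ((α.continuous_integrand k x).intervalIntegrable _ _)).symm
  set f : ℝ → α.X := fun s => ((Circle.exp s : ℂ) ^ (-k)) • α.unitary (Circle.exp s) x with hf
  have h2 : (fun θ : ℝ => α.unitary (Circle.exp t)
      (((Circle.exp θ : ℂ) ^ (-k)) • α.unitary (Circle.exp θ) x))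
      = fun θ => ((Circle.exp t : ℂ) ^ k) • f (θ + t) := by
    funext θ
    rw [map_smul, ← unitary_mul, hf]
    simp only [Circle.exp_add, Circle.coe_mul]
    rw [smul_smul, mul_zpow, mul_comm (Circle.exp t)]
    congr 1
    rw [mul_left_comm, ← zpow_add₀ (Circle.coe_ne_zero _), add_neg_cancel, zpow_zero, mul_one]
  have hper : Function.Periodic f (2 * Real.pi) := fun s => by
    simp only [hf, Circle.exp_add, Circle.exp_two_pi, mul_one]
  have h3 := hper.intervalIntegral_add_eq t 0
  rw [zero_add] at h3
  rw [h1, h2, intervalIntegral.integral_smul, intervalIntegral.integral_comp_add_right f, zero_add,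
    add_comm (2 * Real.pi) t, h3, smul_comm]
  rfl

lemma inner_spectralProj_of_ne {k l : ℤ} (h : k ≠ l) (x y : α.X) :
    inner α.fixed (α.spectralProj k x) (α.spectralProj l y) = 0 := by
  have hkl : ((l - k : ℤ) : ℝ) ≠ 0 := by exact_mod_cast sub_ne_zero.2 h.symm
  set t : ℝ := Real.pi / ((l - k : ℤ) : ℝ) with ht
  have h1 := α.inner_unitary (Circle.exp t) (α.spectralProj k x) (α.spectralProj l y)
  rw [unitary_spectralProj, unitary_spectralProj, PreHilbertModule.inner_smul_left,
    PreHilbertModule.inner_smul_right, smul_smul] at h1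
  have h2 : star ((Circle.exp t : ℂ) ^ k) * (Circle.exp t : ℂ) ^ l = -1 := by
    have h3 : star ((Circle.exp t : ℂ) ^ k) = (Circle.exp t : ℂ) ^ (-k) := by
      rw [star_zpow₀, zpow_neg, ← inv_zpow]
      congr 1
      exact (Circle.coe_inv_eq_conj _).symm
    rw [h3, ← zpow_add₀ (Circle.coe_ne_zero _), neg_add_eq_sub, Circle.coe_exp,
      ← Complex.exp_int_mul, ← Complex.exp_pi_mul_I]
    congr 1
    rw [← mul_assoc]
    congr 1
    rw [ht]
    push_cast
    push_cast at hkl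
    field_simp
    rw [div_self]
    exact_mod_cast hkl
  rw [h2, neg_smul, one_smul] at h1
  have h4 : (2 : ℂ) • inner α.fixed (α.spectralProj k x) (α.spectralProj l y) = 0 := by
    rw [two_smul]
    nth_rewrite 1 [← h1]
    exact neg_add_cancel _
  exact (smul_eq_zero.1 h4).resolve_left two_ne_zero


/-- The generator `D x = ∑ k x_k`, `x_k = Φ_k(x)`, of the circle action on `X`; its domain
consists of all `x` for which `∑ k² (x_k|x_k)` converges. -/
noncomputable def generator : α.X →ₗ.[ℂ] α.X :=
  weightedSum α.fixed α.spectralProj fun _ _ h x y => α.inner_spectralProj_of_ne h x y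

end CircleAction

/-! ### Kasparov modules -/

section Kasparov

/-- `S` is the adjoint of the operator `T` on the Hilbert `B`-module `Y`. -/
def IsAdjointPair (B : Type v) [NonUnitalCStarAlgebra B] {Y : Type w} [NormedAddCommGroup Y]
    [NormedSpace ℂ Y] [HilbertModule B Y] (T S : Y →L[ℂ] Y) : Prop :=
  ∀ x y : Y, inner B (T x) y = inner B x (S y)

/-- The compact endomorphisms of the Hilbert `B`-module `Y`: the norm closure of the linear span
of the operators `Θ_{x,y} z = x (y|z)`. -/
noncomputable def compactEndomorphisms (B : Type v) [NonUnitalCStarAlgebra B] (Y : Type w)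
    [NormedAddCommGroup Y] [NormedSpace ℂ Y] [HilbertModule B Y] : Submodule ℂ (Y →L[ℂ] Y) :=
  (Submodule.span ℂ {T : Y →L[ℂ] Y |
    ∃ x y : Y, ∀ z, T z = PreHilbertModule.ract x (inner B y z)}).topologicalClosure

/-- The Hilbert `B`-module `Y` is generated, as a closed `B`-submodule of itself, by a countable
set. -/
def IsCountablyGenerated (B : Type v) [NonUnitalCStarAlgebra B] (Y : Type w)
    [NormedAddCommGroup Y] [NormedSpace ℂ Y] [HilbertModule B Y] : Prop :=
  ∃ s : Set Y, s.Countable ∧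
    Dense (Submodule.span ℂ (s ∪ {y | ∃ x ∈ s, ∃ b : B, y = PreHilbertModule.ract x b}) : Set Y)

/-- Let `Y` be a Hilbert `B`-module, `φ` a homomorphism from `A` to the operators on `Y` and `T` an
operator on `Y`.  Then `(Y, φ, T)` is an odd Kasparov `A`-`B`-module if `Y` is countably generated,
`φ` is a ⋆-homomorphism to the adjointable operators, `T` is adjointable and
`a(T - T⋆)`, `a(T² - 1)`, `[T, a]` are compact endomorphisms for all `a`. -/
structure IsOddKasparovModule {A : Type u} [NonUnitalCStarAlgebra A] (B : Type v)
    [NonUnitalCStarAlgebra B] {Y : Type w} [NormedAddCommGroup Y] [NormedSpace ℂ Y]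
    [HilbertModule B Y] (φ : A →ₙₐ[ℂ] (Y →L[ℂ] Y)) (T : Y →L[ℂ] Y) : Prop where
  countablyGenerated : IsCountablyGenerated B Y
  isAdjointPair : ∀ a, IsAdjointPair B (φ a) (φ (star a))
  exists_adjoint : ∃ S, IsAdjointPair B T S
  sub_adjoint : ∀ S, IsAdjointPair B T S → ∀ a, φ a * (T - S) ∈ compactEndomorphisms B Y
  sq_sub_one : ∀ a, φ a * (T * T - 1) ∈ compactEndomorphisms B Y
  commutator : ∀ a, T * φ a - φ a * T ∈ compactEndomorphisms B Y

/-- The odd Kasparov `A`-`B`-modules. -/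
structure OddKasparovModule (A B : Type v) [NonUnitalCStarAlgebra A] [NonUnitalCStarAlgebra B] :
    Type (v + 1) where
  /-- the Hilbert `B`-module -/
  carrier : Type v
  [normedAddCommGroup : NormedAddCommGroup carrier]
  [normedSpace : NormedSpace ℂ carrier]
  [hilbertModule : HilbertModule B carrier]
  /-- the left action of `A` -/
  action : A →ₙₐ[ℂ] (carrier →L[ℂ] carrier)
  /-- the operator -/
  op : carrier →L[ℂ] carrier
  isOddKasparovModule : IsOddKasparovModule B action op

attribute [instance] OddKasparovModule.normedAddCommGroup OddKasparovModule.normedSpace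
  OddKasparovModule.hilbertModule

variable {A B : Type v} [NonUnitalCStarAlgebra A] [NonUnitalCStarAlgebra B]

/-- The odd Kasparov `A`-`B`-module `K` is (unitarily equivalent to) the evaluation at `t` of the
odd Kasparov `A`-`C([0,1], B)`-module `H`.  As the evaluation `C([0,1], B) → B` is onto, the
interior tensor product of a Hilbert module with `B` along it is the quotient by the vectors
`x` with `(x|x)(t) = 0`; so the condition is that some map `q` of the underlying spaces is onto
and compatible with the inner products, the module actions, the left actions of `A` and the
operators. -/
def IsEvaluation (H : OddKasparovModule A C(unitInterval, B)) (t : unitInterval)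
    (K : OddKasparovModule A B) : Prop :=
  ∃ q : H.carrier →ₗ[ℂ] K.carrier, Function.Surjective q ∧
    (∀ x y, inner B (q x) (q y) = (inner C(unitInterval, B) x y) t) ∧
    (∀ (x : H.carrier) (f : C(unitInterval, B)),
      q (PreHilbertModule.ract x f) = PreHilbertModule.ract (q x) (f t)) ∧
    (∀ a x, q (H.action a x) = K.action a (q x)) ∧ ∀ x, q (H.op x) = K.op (q x)

/-- Homotopy of odd Kasparov `A`-`B`-modules. -/
def IsHomotopic (K L : OddKasparovModule A B) : Prop :=
  ∃ H : OddKasparovModule A C(unitInterval, B), IsEvaluation H 0 K ∧ IsEvaluation H 1 L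

variable (A B) in
/-- `KK¹(A, B)`: the homotopy classes of odd Kasparov `A`-`B`-modules. -/
def KK1 : Type (v + 1) := Quot (IsHomotopic : OddKasparovModule A B → OddKasparovModule A B → Prop)

/-- The class in `KK¹(A, B)` of an odd Kasparov `A`-`B`-module. -/
def KK1.classOf {Y : Type v} [NormedAddCommGroup Y] [NormedSpace ℂ Y] [HilbertModule B Y]
    (φ : A →ₙₐ[ℂ] (Y →L[ℂ] Y)) (T : Y →L[ℂ] Y) (h : IsOddKasparovModule B φ T) : KK1 A B :=
  Quot.mk _ ⟨Y, φ, T, h⟩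

end Kasparov

/-! ### The bounded transform of an unbounded operator -/

/-- `R` is the operator `(1 + D²)^{-1/2}`, that is, a positive operator whose square is the inverse
of the unbounded operator `1 + D²`, whose domain consists of all `x` in the domain of `D` such that
`D x` is in the domain of `D`. -/
structure IsInvSqrtOneAddSq (B : Type v) [NonUnitalCStarAlgebra B] {Y : Type w}
    [NormedAddCommGroup Y] [NormedSpace ℂ Y] [HilbertModule B Y] (D : Y →ₗ.[ℂ] Y)
    (R : Y →L[ℂ] Y) : Prop where
  nonneg : ∀ x, ∃ b : B, inner B x (R x) = star b * b
  right_inv : ∀ x, ∃ (h : R (R x) ∈ D.domain) (h' : D ⟨R (R x), h⟩ ∈ D.domain),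
    R (R x) + D ⟨D ⟨R (R x), h⟩, h'⟩ = x
  left_inv : ∀ (x : D.domain) (h : D x ∈ D.domain), R (R ((x : Y) + D ⟨D x, h⟩)) = x

/-- `V` is the operator `D (1 + D²)^{-1/2}`. -/
def IsBoundedTransform (B : Type v) [NonUnitalCStarAlgebra B] {Y : Type w}
    [NormedAddCommGroup Y] [NormedSpace ℂ Y] [HilbertModule B Y] (D : Y →ₗ.[ℂ] Y)
    (V : Y →L[ℂ] Y) : Prop :=
  ∃ R : Y →L[ℂ] Y, IsInvSqrtOneAddSq B D R ∧ ∀ x, ∃ h : R x ∈ D.domain, D ⟨R x, h⟩ = V x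

/-! ### Graph C⋆-algebras -/

/-- A directed graph with vertices `V` and edges `E`. -/
structure DirectedGraph (V E : Type u) where
  /-- the source of an edge -/
  s : E → V
  /-- the range of an edge -/
  r : E → V

lemma circle_mul_star (z : Circle) : (z : ℂ) * star (z : ℂ) = 1 := by
  rw [RCLike.star_def, Complex.mul_conj, Circle.normSq_coe, Complex.ofReal_one]

lemma continuous_starHom {A : Type v} {B : Type w} [NonUnitalCStarAlgebra A]
    [NonUnitalCStarAlgebra B] (π : A →⋆ₙₐ[ℂ] B) : Continuous π :=
  AddMonoidHomClass.continuous_of_bound π 1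
    (fun a => by simpa using NonUnitalStarAlgHom.norm_apply_le π a)

namespace DirectedGraph

variable {V E : Type u} (G : DirectedGraph V E)

/-- Every vertex emits and receives only finitely many edges. -/
def LocallyFinite : Prop := ∀ v, {e | G.s e = v}.Finite ∧ {e | G.r e = v}.Finite

/-- Every vertex receives an edge. -/
def NoSources : Prop := ∀ v, ∃ e, G.r e = v

/-- A Cuntz–Krieger family of the (row-finite) graph `G` in the C⋆-algebra `B`. -/
structure CKFamily (B : Type w) [NonUnitalCStarAlgebra B] where
  /-- the projections -/
  p : V → B
  /-- the partial isometries -/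
  S : E → B
  isStarProjection_p : ∀ v, IsStarProjection (p v)
  p_mul_p : ∀ v w, v ≠ w → p v * p w = 0
  S_mul_star_mul_S : ∀ e, S e * star (S e) * S e = S e
  star_S_mul_S : ∀ e, star (S e) * S e = p (G.r e)
  p_eq_sum : ∀ v (h : {e | G.s e = v}.Finite), {e | G.s e = v}.Nonempty →
    p v = ∑ e ∈ h.toFinset, S e * star (S e)

namespace CKFamily

variable {G} {B : Type w} [NonUnitalCStarAlgebra B] (f : G.CKFamily B)

lemma norm_p_le (v : V) : ‖f.p v‖ ≤ 1 := by
  have h := f.isStarProjection_p v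
  have h1 : ‖f.p v‖ = ‖f.p v‖ * ‖f.p v‖ := by
    rw [← CStarRing.norm_star_mul_self, h.isSelfAdjoint.star_eq, h.isIdempotentElem.eq]
  nlinarith [norm_nonneg (f.p v)]

lemma norm_S_le (e : E) : ‖f.S e‖ ≤ 1 := by
  have h1 : ‖f.S e‖ * ‖f.S e‖ ≤ 1 := by
    rw [← CStarRing.norm_star_mul_self, f.star_S_mul_S]
    exact f.norm_p_le _
  nlinarith [norm_nonneg (f.S e)]

/-- The Cuntz–Krieger family `{p_v, z S_e}`. -/
@[reducible]
def rotate (z : Circle) : G.CKFamily B where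
  p := f.p
  S e := (z : ℂ) • f.S e
  isStarProjection_p := f.isStarProjection_p
  p_mul_p := f.p_mul_p
  S_mul_star_mul_S e := by
    simp only [star_smul, smul_mul_assoc, mul_smul_comm, smul_smul]
    rw [mul_comm (star (z : ℂ)), circle_mul_star, mul_one, f.S_mul_star_mul_S]
  star_S_mul_S e := by
    rw [star_smul, smul_mul_assoc, mul_smul_comm, smul_smul, mul_comm, circle_mul_star, one_smul,
      f.star_S_mul_S]
  p_eq_sum v h hv := by
    rw [f.p_eq_sum v h hv]
    refine Finset.sum_congr rfl fun e _ => ?_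
    rw [star_smul, smul_mul_assoc, mul_smul_comm, smul_smul, circle_mul_star, one_smul]

end CKFamily

/-- A C⋆-algebra together with a Cuntz–Krieger family of `G` in it. -/
structure CKRep : Type (u + 1) where
  /-- the C⋆-algebra -/
  carrier : Type u
  [inst : NonUnitalCStarAlgebra carrier]
  /-- the Cuntz–Krieger family -/
  fam : G.CKFamily carrier

attribute [instance] CKRep.inst

/-- The bounded families of elements of all C⋆-algebras with a Cuntz–Krieger family. -/
abbrev Universe : Type (u + 1) := lp (fun i : G.CKRep => i.carrier) ∞

/-- The projections of the universal Cuntz–Krieger family. -/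
noncomputable def univP (v : V) : G.Universe :=
  ⟨fun i => i.fam.p v, memℓp_infty ⟨1, by rintro _ ⟨i, rfl⟩; exact i.fam.norm_p_le v⟩⟩

/-- The partial isometries of the universal Cuntz–Krieger family. -/
noncomputable def univS (e : E) : G.Universe :=
  ⟨fun i => i.fam.S e, memℓp_infty ⟨1, by rintro _ ⟨i, rfl⟩; exact i.fam.norm_S_le e⟩⟩

/-- The C⋆-subalgebra generated by the universal Cuntz–Krieger family. -/
noncomputable def univSubalgebra : NonUnitalStarSubalgebra ℂ G.Universe :=
  (NonUnitalStarAlgebra.adjoin ℂ (Set.range G.univP ∪ Set.range G.univS)).topologicalClosure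

instance : IsClosed (G.univSubalgebra : Set G.Universe) :=
  NonUnitalStarSubalgebra.isClosed_topologicalClosure _

/-- The graph C⋆-algebra `C⋆(G)`: the C⋆-algebra generated by the universal Cuntz–Krieger family,
whose component in a C⋆-algebra with a Cuntz–Krieger family is that Cuntz–Krieger family. -/
def Alg : Type (u + 1) := G.univSubalgebra

noncomputable instance : NonUnitalCStarAlgebra G.Alg :=
  inferInstanceAs (NonUnitalCStarAlgebra G.univSubalgebra)

lemma univP_mem (v : V) : G.univP v ∈ G.univSubalgebra :=
  NonUnitalStarSubalgebra.le_topologicalClosure _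
    (NonUnitalStarAlgebra.subset_adjoin ℂ _ (Or.inl ⟨v, rfl⟩))

lemma univS_mem (e : E) : G.univS e ∈ G.univSubalgebra :=
  NonUnitalStarSubalgebra.le_topologicalClosure _
    (NonUnitalStarAlgebra.subset_adjoin ℂ _ (Or.inr ⟨e, rfl⟩))

/-- The generating projections of `C⋆(G)`. -/
noncomputable def p (v : V) : G.Alg := (⟨G.univP v, G.univP_mem v⟩ : G.univSubalgebra)

/-- The generating partial isometries of `C⋆(G)`. -/
noncomputable def S (e : E) : G.Alg := (⟨G.univS e, G.univS_mem e⟩ : G.univSubalgebra)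

/-- The evaluation of an element of `C⋆(G)` at a Cuntz–Krieger family. -/
noncomputable def eval (i : G.CKRep) : G.Alg →⋆ₙₐ[ℂ] i.carrier where
  toFun a := (a : G.univSubalgebra).1 i
  map_smul' _ _ := rfl
  map_zero' := rfl
  map_add' _ _ := rfl
  map_mul' _ _ := rfl
  map_star' _ := rfl

variable {G} in
lemma alg_ext {a b : G.Alg} (h : ∀ i, G.eval i a = G.eval i b) : a = b :=
  Subtype.ext (lp.ext (funext h))

/-- Induction principle: a closed property of elements of `C⋆(G)`. -/
lemma alg_induction {q : G.Alg → Prop} (hc : IsClosed {a | q a}) (hp : ∀ v, q (G.p v))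
    (hS : ∀ e, q (G.S e)) (h0 : q 0) (hadd : ∀ a b, q a → q b → q (a + b))
    (hmul : ∀ a b, q a → q b → q (a * b)) (hsmul : ∀ (c : ℂ) a, q a → q (c • a))
    (hstar : ∀ a, q a → q (star a)) (a : G.Alg) : q a := by
  let T : NonUnitalStarSubalgebra ℂ G.Alg :=
    { carrier := {a | q a}
      add_mem' := fun {a b} ha hb => hadd a b ha hb
      zero_mem' := h0
      mul_mem' := fun {a b} ha hb => hmul a b ha hb
      smul_mem' := fun c a ha => hsmul c a ha
      star_mem' := fun {a} ha => hstar a ha }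
  let ι : G.Alg →⋆ₙₐ[ℂ] G.Universe := NonUnitalStarSubalgebraClass.subtype G.univSubalgebra
  have hι : Topology.IsClosedEmbedding ι :=
    (inferInstance : IsClosed (G.univSubalgebra : Set G.Universe)).isClosedEmbedding_subtypeVal
  have h1 : G.univSubalgebra ≤ T.map ι := by
    refine NonUnitalStarSubalgebra.topologicalClosure_minimal _ ?_ ?_
    · refine NonUnitalStarAlgebra.adjoin_le ?_
      rintro _ (⟨v, rfl⟩ | ⟨e, rfl⟩)
      · exact ⟨G.p v, hp v, rfl⟩
      · exact ⟨G.S e, hS e, rfl⟩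
    · exact hι.isClosedMap _ hc
  obtain ⟨b, hb, hba⟩ := h1 (show ι a ∈ G.univSubalgebra from Subtype.property a)
  exact (hι.injective hba) ▸ hb

/-- The generators of `C⋆(G)` form a Cuntz–Krieger family. -/
noncomputable def univFamily : G.CKFamily G.Alg where
  p := G.p
  S := G.S
  isStarProjection_p v :=
    ⟨alg_ext fun i => (i.fam.isStarProjection_p v).isIdempotentElem,
      alg_ext fun i => (i.fam.isStarProjection_p v).isSelfAdjoint⟩
  p_mul_p v w h := alg_ext fun i => i.fam.p_mul_p v w h
  S_mul_star_mul_S e := alg_ext fun i => i.fam.S_mul_star_mul_S e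
  star_S_mul_S e := alg_ext fun i => i.fam.star_S_mul_S e
  p_eq_sum v h hv := alg_ext fun i => by
    rw [map_sum]
    exact i.fam.p_eq_sum v h hv

variable {G} in
lemma alg_hom_ext {B : Type w} [NonUnitalCStarAlgebra B] {π π' : G.Alg →⋆ₙₐ[ℂ] B}
    (hp : ∀ v, π (G.p v) = π' (G.p v)) (hS : ∀ e, π (G.S e) = π' (G.S e)) : π = π' := by
  ext a
  refine G.alg_induction (isClosed_eq (continuous_starHom π) (continuous_starHom π')) hp hS
    ?_ ?_ ?_ ?_ ?_ a
  · rw [map_zero, map_zero]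
  · intro a b ha hb
    rw [map_add, map_add, ha, hb]
  · intro a b ha hb
    rw [map_mul, map_mul, ha, hb]
  · intro c a ha
    rw [map_smul, map_smul, ha]
  · intro a ha
    rw [map_star, map_star, ha]

/-- The universal property of `C⋆(G)`. -/
theorem exists_unique_hom {B : Type u} [NonUnitalCStarAlgebra B] (f : G.CKFamily B) :
    ∃! π : G.Alg →⋆ₙₐ[ℂ] B, (∀ v, π (G.p v) = f.p v) ∧ ∀ e, π (G.S e) = f.S e :=
  ⟨G.eval ⟨B, f⟩, ⟨fun _ => rfl, fun _ => rfl⟩,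
    fun _ h => alg_hom_ext (fun v => h.1 v) (fun e => h.2 e)⟩

/-- The Cuntz–Krieger family `{p_v, z S_e}` in the same C⋆-algebra. -/
@[reducible]
def CKRep.rotate (z : Circle) (i : G.CKRep) : G.CKRep := ⟨i.carrier, i.fam.rotate z⟩

/-- Reindexing of the components along the map which takes `{p_v, S_e}` to `{p_v, z S_e}`. -/
noncomputable def univGauge (z : Circle) : G.Universe →⋆ₙₐ[ℂ] G.Universe where
  toFun a := ⟨fun i => a.1 (CKRep.rotate G z i), memℓp_infty ⟨‖a‖, by
    rintro _ ⟨i, rfl⟩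
    exact lp.norm_apply_le_norm ENNReal.top_ne_zero a (CKRep.rotate G z i)⟩⟩
  map_smul' _ _ := rfl
  map_zero' := rfl
  map_add' _ _ := rfl
  map_mul' _ _ := rfl
  map_star' _ := rfl

lemma univGauge_mem (z : Circle) (a : G.Alg) :
    G.univGauge z (a : G.univSubalgebra).1 ∈ G.univSubalgebra := by
  refine G.alg_induction
    (q := fun a => G.univGauge z (a : G.univSubalgebra).1 ∈ G.univSubalgebra)
    ?_ ?_ ?_ ?_ ?_ ?_ ?_ ?_ a
  · exact (inferInstance : IsClosed (G.univSubalgebra : Set G.Universe)).preimage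
      ((continuous_starHom (G.univGauge z)).comp continuous_subtype_val)
  · exact fun v => G.univP_mem v
  · exact fun e => SMulMemClass.smul_mem (z : ℂ) (G.univS_mem e)
  · exact zero_mem G.univSubalgebra
  · exact fun a b ha hb => add_mem ha hb
  · exact fun a b ha hb => mul_mem ha hb
  · exact fun c a ha => SMulMemClass.smul_mem c ha
  · exact fun a ha => star_mem ha

/-- The automorphism `γ_z` of `C⋆(G)`, with `γ_z(p_v) = p_v` and `γ_z(S_e) = z S_e`. -/
noncomputable def gaugeHom (z : Circle) : G.Alg →⋆ₙₐ[ℂ] G.Alg where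
  toFun a := (⟨G.univGauge z (a : G.univSubalgebra).1, G.univGauge_mem z a⟩ : G.univSubalgebra)
  map_smul' _ _ := rfl
  map_zero' := rfl
  map_add' _ _ := rfl
  map_mul' _ _ := rfl
  map_star' _ := rfl

lemma gaugeHom_p (z : Circle) (v : V) : G.gaugeHom z (G.p v) = G.p v := rfl

lemma gaugeHom_S (z : Circle) (e : E) : G.gaugeHom z (G.S e) = (z : ℂ) • G.S e := rfl

lemma continuous_gaugeHom (a : G.Alg) : Continuous fun z => G.gaugeHom z a := by
  refine G.alg_induction (q := fun a => Continuous fun z => G.gaugeHom z a)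
    ?_ ?_ ?_ ?_ ?_ ?_ ?_ ?_ a
  · rw [← isSeqClosed_iff_isClosed]
    intro f y hf hy
    refine continuous_of_uniform_approx_of_continuous fun s hs => ?_
    obtain ⟨ε, hε, hεs⟩ := Metric.mem_uniformity_dist.1 hs
    obtain ⟨n, hn⟩ := ((Metric.tendsto_nhds.1 hy) ε hε).exists
    refine ⟨fun z => G.gaugeHom z (f n), hf n, fun z => hεs ?_⟩
    rw [dist_comm, dist_eq_norm, ← map_sub]
    refine (NonUnitalStarAlgHom.norm_apply_le (G.gaugeHom z) _).trans_lt ?_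
    rw [← dist_eq_norm]
    exact hn
  · exact fun v => (continuous_const : Continuous fun _ : Circle => G.p v)
  · exact fun e => (continuous_subtype_val.smul continuous_const :
      Continuous fun z : Circle => (z : ℂ) • G.S e)
  · simp only [map_zero]
    exact continuous_const
  · intro a b ha hb
    simp only [map_add]
    exact ha.add hb
  · intro a b ha hb
    simp only [map_mul]
    exact ha.mul hb
  · intro c a ha
    simp only [map_smul]
    exact ha.const_smul c
  · intro a ha
    simp only [map_star]
    exact ha.star

/-- The gauge action on `C⋆(G)`. -/
noncomputable def gauge : CircleAction G.Alg where
  act := G.gaugeHom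
  act_one a := by
    have h : G.gaugeHom 1 = NonUnitalStarAlgHom.id ℂ G.Alg :=
      alg_hom_ext (fun v => rfl) fun e => by
        rw [gaugeHom_S, Circle.coe_one, one_smul]
        rfl
    rw [h]
    rfl
  act_mul z w a := by
    have h : G.gaugeHom (z * w) = (G.gaugeHom z).comp (G.gaugeHom w) :=
      alg_hom_ext (fun v => rfl) fun e => by
        rw [NonUnitalStarAlgHom.comp_apply, gaugeHom_S, gaugeHom_S, map_smul, gaugeHom_S,
          smul_smul, Circle.coe_mul, mul_comm]
    rw [h]
    rfl
  continuous_act := G.continuous_gaugeHom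

end DirectedGraph

end GraphKK

/-!
The projections `Φ_k` grade `X`, and `D = ∑ k Φ_k`, so that `D (1 + D²)^{-1/2}` can only be the
diagonal operator `∑ k (1 + k²)^{-1/2} Φ_k`. Its coefficients are real, have squares tending to `1`
at `±∞`, and increments by a fixed step tending to `0`. An element `a` of degree `n` maps the range
of `Φ_k` to that of `Φ_{k+n}`, so `[V, a]` is again `a` times a diagonal operator with coefficients
vanishing at infinity. Everything thus reduces to the compactness of `a Φ_k` for all `a` and `k`.

For `b` of degree `k` one has `Θ_{a,b} = a b⋆ Φ_k`. This settles `p_v Φ_0`, and the Cuntz–Krieger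
relations propagate compactness in both directions: `p_v = ∑ S_e p_{r(e)} S_e⋆` leads from `k` to
`k + 1`, and `p_{r(e)} = S_e⋆ p_{s(e)} S_e` from `k` to `k - 1`. The first relation fails when `v`
is a sink; then the products `p_v S_{e₁}⋆ ⋯ S_{eₙ}⋆` span a dense subspace of `p_v C⋆(G)`, so
that `p_v Φ_k = 0` for `k > 0`.
-/

namespace GraphKK

open scoped BoundedContinuousFunction

section HilbertModules

variable {B : Type v} [NonUnitalCStarAlgebra B] {Y : Type w} [NormedAddCommGroup Y]
  [NormedSpace ℂ Y] [HilbertModule B Y]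

namespace HilbertModule

open PreHilbertModule

lemma norm_inner_le (x y : Y) : ‖inner B x y‖ ≤ ‖x‖ * ‖y‖ := by
  refine le_of_sq_le_sq ?_ (by positivity)
  rw [mul_pow, norm_sq_eq (B := B) x, norm_sq_eq (B := B) y]
  exact norm_inner_sq_le x y

variable (B) in
/-- The inner product `y ↦ (x|y)` as a bounded linear map. -/
noncomputable def innerCLM (x : Y) : Y →L[ℂ] B :=
  LinearMap.mkContinuous
    { toFun := fun y => inner B x y
      map_add' := PreHilbertModule.inner_add_right x
      map_smul' := fun c y => PreHilbertModule.inner_smul_right c x y } ‖x‖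
    (norm_inner_le x)

lemma innerCLM_apply (x y : Y) : innerCLM B x y = inner B x y := rfl

lemma eq_zero_of_inner_self {x : Y} (h : inner B x x = 0) : x = 0 := by
  have hx := norm_sq_eq (B := B) x
  rwa [h, norm_zero, sq_eq_zero_iff, norm_eq_zero] at hx

lemma ext_inner {x y : Y} (h : ∀ z, inner B z x = inner B z y) : x = y :=
  sub_eq_zero.1 (eq_zero_of_inner_self (B := B)
    (by rw [PreHilbertModule.inner_sub_right, h, sub_self]))

lemma norm_ract_le (x : Y) (b : B) : ‖ract x b‖ ≤ ‖x‖ * ‖b‖ := by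
  refine le_of_sq_le_sq ?_ (by positivity)
  rw [norm_sq_eq (B := B), inner_ract_left, inner_ract_right]
  calc ‖star b * (inner B x x * b)‖
      ≤ ‖star b‖ * (‖inner B x x‖ * ‖b‖) :=
        (norm_mul_le _ _).trans (by gcongr; exact norm_mul_le _ _)
    _ = (‖x‖ * ‖b‖) ^ 2 := by rw [norm_star, ← norm_sq_eq]; ring

variable (B) in
/-- The operator `Θ_{x,y} z = x (y|z)`. -/
noncomputable def rankOne (x y : Y) : Y →L[ℂ] Y :=
  LinearMap.mkContinuous
    { toFun := fun z => ract x (inner B y z)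
      map_add' := fun z z' => by rw [PreHilbertModule.inner_add_right, ract_add_right]
      map_smul' := fun c z => by
        rw [PreHilbertModule.inner_smul_right, ract_smul_right, RingHom.id_apply] }
    (‖x‖ * ‖y‖)
    (fun z => (norm_ract_le x _).trans (by
      rw [mul_assoc]
      gcongr
      exact norm_inner_le y z))

lemma rankOne_apply (x y z : Y) : rankOne B x y z = ract x (inner B y z) := rfl

lemma eq_smul_of_sq_eq {R : Y →L[ℂ] Y} (hR : ∀ x, ∃ b : B, inner B x (R x) = star b * b) {c : ℝ}
    (hc : 0 < c) {y : Y} (hy : R (R y) = (c : ℂ) ^ 2 • y) : R y = (c : ℂ) • y := by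
  let := CStarAlgebra.spectralOrder B
  have := CStarAlgebra.spectralOrderedRing B
  set w := R y - (c : ℂ) • y with hw
  have hRw : R w = -((c : ℂ) • w) := by
    rw [hw, map_sub, map_smul, hy, smul_sub, smul_smul, ← pow_two]
    abel
  obtain ⟨b, hb⟩ := hR w
  rw [hRw, PreHilbertModule.inner_neg_right, PreHilbertModule.inner_smul_right] at hb
  have h_nonneg : (0 : B) ≤ (c : ℂ) • inner B w w := by
    rw [Complex.coe_smul]
    exact smul_nonneg hc.le (inner_self_nonneg' w)
  have h_nonpos : (0 : B) ≤ -((c : ℂ) • inner B w w) := hb ▸ star_mul_self_nonneg b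
  have h_zero : (c : ℂ) • inner B w w = 0 := le_antisymm (neg_nonneg.1 h_nonpos) h_nonneg
  exact sub_eq_zero.1 (eq_zero_of_inner_self
    ((smul_eq_zero.1 h_zero).resolve_left (Complex.ofReal_ne_zero.2 hc.ne')))

end HilbertModule

open HilbertModule

namespace IsAdjointPair

variable {T S S' : Y →L[ℂ] Y}

lemma symm (h : IsAdjointPair B T S) : IsAdjointPair B S T := fun x y => by
  rw [← PreHilbertModule.star_inner, ← h, PreHilbertModule.star_inner]

lemma eq (h : IsAdjointPair B T S) (h' : IsAdjointPair B T S') : S = S' :=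
  ContinuousLinearMap.ext fun y => ext_inner (B := B) fun z => by rw [← h, h']

lemma map_ract (h : IsAdjointPair B T S) (x : Y) (b : B) :
    T (PreHilbertModule.ract x b) = PreHilbertModule.ract (T x) b :=
  ext_inner (B := B) fun z => by
    rw [← h.symm, PreHilbertModule.inner_ract_right, PreHilbertModule.inner_ract_right, h.symm]

lemma mul_rankOne (h : IsAdjointPair B T S) (x y : Y) :
    T * rankOne B x y = rankOne B (T x) y :=
  ContinuousLinearMap.ext fun _ => h.map_ract _ _

lemma rankOne_mul (h : IsAdjointPair B T S) (x y : Y) :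
    rankOne B x y * T = rankOne B x (S y) :=
  ContinuousLinearMap.ext fun z => by
    rw [mul_apply_eq_comp, rankOne_apply, rankOne_apply, h.symm]

end IsAdjointPair

namespace compactEndomorphisms

lemma isClosed : IsClosed (compactEndomorphisms B Y : Set (Y →L[ℂ] Y)) :=
  Submodule.isClosed_topologicalClosure _

lemma rankOne_mem (x y : Y) : rankOne B x y ∈ compactEndomorphisms B Y :=
  Submodule.le_topologicalClosure _ (Submodule.subset_span ⟨x, y, fun _ => rfl⟩)

lemma le_of_rankOne_mem {M : Submodule ℂ (Y →L[ℂ] Y)} (hM : IsClosed (M : Set (Y →L[ℂ] Y)))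
    (h : ∀ x y, rankOne B x y ∈ M) : compactEndomorphisms B Y ≤ M := by
  refine Submodule.topologicalClosure_minimal _ (Submodule.span_le.2 ?_) hM
  rintro T ⟨x, y, hT⟩
  obtain rfl : T = rankOne B x y := ContinuousLinearMap.ext hT
  exact h x y

variable {T S K : Y →L[ℂ] Y}

lemma mul_mem_left (hT : IsAdjointPair B T S) (hK : K ∈ compactEndomorphisms B Y) :
    T * K ∈ compactEndomorphisms B Y :=
  le_of_rankOne_mem (M := (compactEndomorphisms B Y).comap (LinearMap.mulLeft ℂ T))
    (isClosed.preimage (continuous_const.mul continuous_id))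
    (fun x y => by
      rw [Submodule.mem_comap, LinearMap.mulLeft_apply, hT.mul_rankOne]
      exact rankOne_mem (T x) y) hK

lemma mul_mem_right (hT : IsAdjointPair B T S) (hK : K ∈ compactEndomorphisms B Y) :
    K * T ∈ compactEndomorphisms B Y :=
  le_of_rankOne_mem (M := (compactEndomorphisms B Y).comap (LinearMap.mulRight ℂ T))
    (isClosed.preimage (continuous_id.mul continuous_const))
    (fun x y => by
      rw [Submodule.mem_comap, LinearMap.mulRight_apply, hT.rankOne_mul]
      exact rankOne_mem x (S y)) hK

end compactEndomorphisms

variable (B) in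
/-- Mutually orthogonal contractive projections `P_k` of a Hilbert module, the ranges of which
span a dense subspace. -/
structure IsGrading (P : ℤ → Y →ₗ[ℂ] Y) : Prop where
  orthogonal : ∀ k l, k ≠ l → ∀ x y, inner B (P k x) (P l y) = 0
  proj_self : ∀ k x, P k (P k x) = P k x
  proj_of_ne : ∀ k l, k ≠ l → ∀ x, P k (P l x) = 0
  norm_le : ∀ k x, ‖P k x‖ ≤ ‖x‖
  dense : Dense (Submodule.span ℂ {y | ∃ k x, y = P k x} : Set Y)

namespace IsGrading

variable {P : ℤ → Y →ₗ[ℂ] Y} (hP : IsGrading B P)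

include hP

/-- The projection `P_k` as a bounded operator. -/
noncomputable def proj (k : ℤ) : Y →L[ℂ] Y :=
  (P k).mkContinuous 1 fun x => by rw [one_mul]; exact hP.norm_le k x

lemma proj_apply (k : ℤ) (x : Y) : hP.proj k x = P k x := rfl

lemma ext_clm {F : Type*} [NormedAddCommGroup F] [NormedSpace ℂ F] {S T : Y →L[ℂ] F}
    (h : ∀ k x, S (P k x) = T (P k x)) : S = T :=
  ContinuousLinearMap.ext_on hP.dense (by rintro _ ⟨k, x, rfl⟩; exact h k x)

lemma inner_proj_proj (k : ℤ) (x y : Y) : inner B (P k x) (P k y) = inner B (P k x) y := by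
  have h : innerCLM B (P k x) ∘L hP.proj k = innerCLM B (P k x) := by
    refine hP.ext_clm fun l z => ?_
    simp only [ContinuousLinearMap.comp_apply, proj_apply, innerCLM_apply]
    obtain rfl | hkl := eq_or_ne k l
    · rw [hP.proj_self]
    · rw [hP.proj_of_ne k l hkl, PreHilbertModule.inner_zero_right, hP.orthogonal k l hkl]
  exact DFunLike.congr_fun h y

lemma inner_proj_left (k : ℤ) (x y : Y) : inner B (P k x) y = inner B x (P k y) := by
  rw [← hP.inner_proj_proj, ← PreHilbertModule.star_inner, hP.inner_proj_proj k y x,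
    PreHilbertModule.star_inner]

lemma norm_sq_sum (s : Finset ℤ) (c : ℤ → ℂ) (x : Y) :
    ‖∑ k ∈ s, c k • P k x‖ ^ 2 = ‖∑ k ∈ s, ‖c k‖ ^ 2 • inner B (P k x) (P k x)‖ := by
  rw [norm_sq_eq (B := B), inner_sum_sum]
  · congr 1
    refine Finset.sum_congr rfl fun k _ => ?_
    rw [PreHilbertModule.inner_smul_left, PreHilbertModule.inner_smul_right, smul_smul,
      ← Complex.coe_smul, RCLike.star_def, RCLike.conj_mul, Complex.ofReal_pow]
    rfl
  · intro k l hkl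
    rw [PreHilbertModule.inner_smul_left, PreHilbertModule.inner_smul_right,
      hP.orthogonal k l hkl, smul_zero, smul_zero]

lemma norm_sq_sum_proj (s : Finset ℤ) (x : Y) :
    ‖∑ k ∈ s, P k x‖ ^ 2 = ‖∑ k ∈ s, inner B (P k x) (P k x)‖ := by
  simpa only [one_smul, norm_one, one_pow] using hP.norm_sq_sum s (fun _ => 1) x

lemma norm_sum_proj_le (s : Finset ℤ) (x : Y) : ‖∑ k ∈ s, P k x‖ ≤ ‖x‖ := by
  have h_inner : inner B x (∑ k ∈ s, P k x) = ∑ k ∈ s, inner B (P k x) (P k x) := by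
    rw [← innerCLM_apply x, map_sum]
    exact Finset.sum_congr rfl fun k _ => by
      rw [hP.inner_proj_proj, hP.inner_proj_left, innerCLM_apply]
  have h_sq : ‖∑ k ∈ s, P k x‖ ^ 2 ≤ ‖x‖ * ‖∑ k ∈ s, P k x‖ := by
    rw [hP.norm_sq_sum_proj, ← h_inner]
    exact norm_inner_le x _
  by_contra! h
  nlinarith [norm_nonneg x]

lemma norm_sum_le (s : Finset ℤ) {c : ℤ → ℂ} {M : ℝ} (hM0 : 0 ≤ M) (hM : ∀ k ∈ s, ‖c k‖ ≤ M)
    (x : Y) : ‖∑ k ∈ s, c k • P k x‖ ≤ M * ‖x‖ := by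
  let := CStarAlgebra.spectralOrder B
  have := CStarAlgebra.spectralOrderedRing B
  have h_sq : ‖∑ k ∈ s, c k • P k x‖ ^ 2 ≤ (M * ‖∑ k ∈ s, P k x‖) ^ 2 := by
    rw [hP.norm_sq_sum, mul_pow, hP.norm_sq_sum_proj, ← Real.norm_of_nonneg (sq_nonneg M),
      ← norm_smul, Finset.smul_sum]
    refine CStarAlgebra.norm_le_norm_of_nonneg_of_le
      (Finset.sum_nonneg fun k _ => smul_nonneg (by positivity)
        (PreHilbertModule.inner_self_nonneg' _))
      (Finset.sum_le_sum fun k hk => ?_)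
    refine smul_le_smul_of_nonneg_right ?_ (PreHilbertModule.inner_self_nonneg' _)
    gcongr
    exact hM k hk
  calc ‖∑ k ∈ s, c k • P k x‖ ≤ M * ‖∑ k ∈ s, P k x‖ := le_of_sq_le_sq h_sq (by positivity)
    _ ≤ M * ‖x‖ := by gcongr; exact hP.norm_sum_proj_le s x

lemma exists_finset_of_mem_span {y : Y} (hy : y ∈ Submodule.span ℂ {y | ∃ k x, y = P k x}) :
    ∃ s : Finset ℤ, ∀ k ∉ s, P k y = 0 := by
  classical
  induction hy using Submodule.span_induction with
  | mem y h =>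
    obtain ⟨k, x, rfl⟩ := h
    exact ⟨{k}, fun l hl => hP.proj_of_ne l k (Finset.notMem_singleton.1 hl) x⟩
  | zero => exact ⟨∅, fun k _ => map_zero _⟩
  | add x y _ _ hx hy =>
    obtain ⟨s, hs⟩ := hx
    obtain ⟨t, ht⟩ := hy
    refine ⟨s ∪ t, fun k hk => ?_⟩
    rw [Finset.notMem_union] at hk
    rw [map_add, hs k hk.1, ht k hk.2, add_zero]
  | smul c x _ hx =>
    obtain ⟨s, hs⟩ := hx
    exact ⟨s, fun k hk => by rw [map_smul, hs k hk, smul_zero]⟩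

lemma exists_finset_norm_sum_lt (c : ℤ →ᵇ ℂ) (x : Y) {ε : ℝ} (hε : 0 < ε) :
    ∃ s : Finset ℤ, ∀ t, Disjoint t s → ‖∑ k ∈ t, c k • P k x‖ < ε := by
  obtain ⟨y, hy, hxy⟩ := hP.dense.exists_dist_lt x (show 0 < ε / (‖c‖ + 1) by positivity)
  obtain ⟨s, hs⟩ := hP.exists_finset_of_mem_span hy
  refine ⟨s, fun t ht => ?_⟩
  rw [dist_eq_norm, lt_div_iff₀ (by positivity)] at hxy
  calc ‖∑ k ∈ t, c k • P k x‖ = ‖∑ k ∈ t, c k • P k (x - y)‖ := by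
        congr 1
        refine Finset.sum_congr rfl fun k hk => ?_
        rw [map_sub, hs k (Finset.disjoint_left.1 ht hk), sub_zero]
    _ ≤ ‖c‖ * ‖x - y‖ := hP.norm_sum_le t (norm_nonneg c) (fun k _ => c.norm_coe_le_norm k) _
    _ < ε := by nlinarith [norm_nonneg (x - y)]

lemma summable (c : ℤ →ᵇ ℂ) (x : Y) : Summable fun k => c k • P k x := by
  have := complete B (X := Y)
  exact summable_iff_vanishing_norm.2 fun ε hε => hP.exists_finset_norm_sum_lt c x hε

lemma summable_inner (x : Y) : Summable fun k => inner B (P k x) (P k x) := by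
  refine summable_iff_vanishing_norm.2 fun ε hε => ?_
  obtain ⟨s, hs⟩ := hP.exists_finset_norm_sum_lt 1 x (Real.sqrt_pos.2 hε)
  refine ⟨s, fun t ht => ?_⟩
  have h_lt := hs t ht
  simp only [BoundedContinuousFunction.coe_one, Pi.one_apply, one_smul] at h_lt
  rw [← hP.norm_sq_sum_proj, ← Real.sq_sqrt hε.le]
  gcongr

/-- The operator `∑ c_k P_k`, for bounded `c`. -/
noncomputable def diag (c : ℤ →ᵇ ℂ) : Y →L[ℂ] Y :=
  LinearMap.mkContinuous
    { toFun := fun x => ∑' k, c k • P k x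
      map_add' := fun x y => by
        rw [← (hP.summable c x).tsum_add (hP.summable c y)]
        simp only [map_add, smul_add]
      map_smul' := fun z x => by
        rw [RingHom.id_apply, ← (hP.summable c x).tsum_const_smul z]
        simp only [map_smul, smul_comm z] } ‖c‖
    (fun x => le_of_tendsto (hP.summable c x).hasSum.norm (Filter.Eventually.of_forall fun s =>
      hP.norm_sum_le s (norm_nonneg c) (fun k _ => c.norm_coe_le_norm k) x))

lemma hasSum_diag (c : ℤ →ᵇ ℂ) (x : Y) : HasSum (fun k => c k • P k x) (hP.diag c x) :=
  (hP.summable c x).hasSum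

lemma diag_proj (c : ℤ →ᵇ ℂ) (k : ℤ) (x : Y) : hP.diag c (P k x) = c k • P k x := by
  refine (hP.hasSum_diag c (P k x)).unique ?_
  convert hasSum_single k fun l hl => ?_ using 1
  · rw [hP.proj_self]
  · rw [hP.proj_of_ne l k hl, smul_zero]

lemma proj_diag (c : ℤ →ᵇ ℂ) (k : ℤ) (x : Y) : P k (hP.diag c x) = c k • P k x := by
  have h : hP.proj k ∘L hP.diag c = c k • hP.proj k := by
    refine hP.ext_clm fun l z => ?_
    rw [ContinuousLinearMap.comp_apply, diag_proj, map_smul, smul_apply, proj_apply]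
    obtain rfl | hkl := eq_or_ne k l
    · rfl
    · rw [hP.proj_of_ne k l hkl, smul_zero, smul_zero]
  exact DFunLike.congr_fun h x

lemma diag_mul (c d : ℤ →ᵇ ℂ) : hP.diag (c * d) = hP.diag c * hP.diag d :=
  hP.ext_clm fun k x => by
    rw [mul_apply_eq_comp, diag_proj, diag_proj, map_smul, diag_proj, smul_smul, mul_comm (d k)]
    rfl

lemma diag_add (c d : ℤ →ᵇ ℂ) : hP.diag (c + d) = hP.diag c + hP.diag d :=
  hP.ext_clm fun k x => by
    rw [add_apply, diag_proj, diag_proj, diag_proj, ← add_smul]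
    rfl

lemma diag_one : hP.diag 1 = 1 :=
  hP.ext_clm fun k x => by rw [diag_proj]; exact one_smul _ _

lemma hasSum_proj (x : Y) : HasSum (fun k => P k x) x := by
  simpa only [diag_one, BoundedContinuousFunction.coe_one, Pi.one_apply, one_smul,
    one_apply_eq_self] using hP.hasSum_diag 1 x

lemma ext {x y : Y} (h : ∀ k, P k x = P k y) : x = y :=
  (hP.hasSum_proj x).unique (by simpa only [h] using hP.hasSum_proj y)

lemma isAdjointPair_diag (c : ℤ →ᵇ ℂ) : IsAdjointPair B (hP.diag c) (hP.diag (star c)) :=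
  fun x y => by
    have h_left : HasSum (fun k => star (c k • inner B y (P k x)))
        (star (inner B y (hP.diag c x))) := by
      simpa only [map_smul, innerCLM_apply] using ((hP.hasSum_diag c x).mapL (innerCLM B y)).star
    have h_right : HasSum (fun k => star (c k) • inner B x (P k y))
        (inner B x (hP.diag (star c) y)) := by
      simpa only [map_smul, innerCLM_apply, BoundedContinuousFunction.star_apply] using
        (hP.hasSum_diag (star c) y).mapL (innerCLM B x)
    simp only [star_smul, PreHilbertModule.star_inner, hP.inner_proj_left] at h_left
    exact h_left.unique h_right

lemma exists_inner_diag_eq_star_mul_self (c : ℤ →ᵇ ℂ) (x : Y) :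
    ∃ b : B, inner B x (hP.diag (star c * c) x) = star b * b := by
  obtain ⟨b, hb⟩ := PreHilbertModule.inner_self_nonneg (B := B) (hP.diag c x)
  exact ⟨b, by rw [diag_mul, mul_apply_eq_comp, ← hP.isAdjointPair_diag, hb]⟩

lemma norm_diag_sub_sum_le (c : ℤ →ᵇ ℂ) (s : Finset ℤ) {M : ℝ} (hM0 : 0 ≤ M)
    (hM : ∀ k ∉ s, ‖c k‖ ≤ M) : ‖hP.diag c - ∑ k ∈ s, c k • hP.proj k‖ ≤ M := by
  classical
  refine ContinuousLinearMap.opNorm_le_bound _ hM0 fun x => ?_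
  refine le_of_tendsto ((hP.hasSum_diag c x).sub_const _).norm
    (Filter.eventually_atTop.2 ⟨s, fun t hst => ?_⟩)
  have h_sum : (∑ k ∈ s, c k • hP.proj k) x = ∑ k ∈ s, c k • P k x := sum_apply _ _ _
  rw [ContinuousLinearMap.coe_coe, h_sum, ← Finset.sum_sdiff_eq_sub hst]
  exact hP.norm_sum_le _ hM0 (fun k hk => hM k (Finset.mem_sdiff.1 hk).2) x

lemma hasSum_smul_proj {c : ℤ →ᵇ ℂ} (hc : Filter.Tendsto c Filter.cofinite (nhds 0)) :
    HasSum (fun k => c k • hP.proj k) (hP.diag c) := by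
  refine Metric.tendsto_nhds.2 fun ε hε => ?_
  have hfin : {k | ¬ ‖c k‖ < ε / 2}.Finite := by
    simpa only [dist_zero_right] using
      Filter.eventually_cofinite.1 (Metric.tendsto_nhds.1 hc _ (half_pos hε))
  refine Filter.eventually_atTop.2 ⟨hfin.toFinset, fun s hs => ?_⟩
  rw [dist_comm, dist_eq_norm]
  refine (hP.norm_diag_sub_sum_le c s (half_pos hε).le fun k hk => ?_).trans_lt (half_lt_self hε)
  by_contra! h
  exact hk (hs (hfin.mem_toFinset.2 h.not_gt))

lemma mul_diag_mem_compactEndomorphisms {T : Y →L[ℂ] Y}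
    (hT : ∀ k, T * hP.proj k ∈ compactEndomorphisms B Y) {c : ℤ →ᵇ ℂ}
    (hc : Filter.Tendsto c Filter.cofinite (nhds 0)) :
    T * hP.diag c ∈ compactEndomorphisms B Y := by
  refine compactEndomorphisms.isClosed.mem_of_tendsto ((hP.hasSum_smul_proj hc).mul_left T)
    (Filter.Eventually.of_forall fun s => Submodule.sum_mem _ fun k _ => ?_)
  rw [mul_smul_comm]
  exact Submodule.smul_mem _ _ (hT k)

end IsGrading

end HilbertModules

section BoundedTransform

/-- The coefficients `(1 + k²)^{-1/2}` of `(1 + D²)^{-1/2}`, written as cosines of `arctan k`. -/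
noncomputable def invSqrtCoeff : ℤ →ᵇ ℂ :=
  .ofNormedAddCommGroupDiscrete (fun k => Real.cos (Real.arctan k)) 1
    fun _ => by rw [Complex.norm_real]; exact Real.abs_cos_le_one _

/-- The coefficients `k (1 + k²)^{-1/2}` of `D (1 + D²)^{-1/2}`, written as sines of `arctan k`. -/
noncomputable def transformCoeff : ℤ →ᵇ ℂ :=
  .ofNormedAddCommGroupDiscrete (fun k => Real.sin (Real.arctan k)) 1
    fun _ => by rw [Complex.norm_real]; exact Real.abs_sin_le_one _

lemma invSqrtCoeff_apply (k : ℤ) : invSqrtCoeff k = Real.cos (Real.arctan k) := rfl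

lemma transformCoeff_apply (k : ℤ) : transformCoeff k = Real.sin (Real.arctan k) := rfl

lemma star_transformCoeff : star transformCoeff = transformCoeff :=
  DFunLike.ext _ _ fun _ => Complex.conj_ofReal _

lemma exists_star_mul_self_eq_invSqrtCoeff : ∃ d : ℤ →ᵇ ℂ, star d * d = invSqrtCoeff := by
  refine ⟨.ofNormedAddCommGroupDiscrete (fun k => √(Real.cos (Real.arctan k))) 1 fun k => ?_,
    DFunLike.ext _ _ fun k => ?_⟩
  · rw [Complex.norm_real, Real.norm_of_nonneg (Real.sqrt_nonneg _)]
    exact Real.sqrt_le_one.2 (Real.cos_le_one _)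
  · change star ((√(Real.cos (Real.arctan k)) : ℝ) : ℂ) * (√(Real.cos (Real.arctan k)) : ℝ) = _
    rw [Complex.star_def, Complex.conj_ofReal, ← Complex.ofReal_mul,
      Real.mul_self_sqrt (Real.cos_arctan_pos _).le, invSqrtCoeff_apply]

lemma intCast_mul_invSqrtCoeff (k : ℤ) : (k : ℂ) * invSqrtCoeff k = transformCoeff k := by
  have h := Real.tan_mul_cos (Real.cos_arctan_pos k).ne'
  rw [Real.tan_arctan] at h
  rw [invSqrtCoeff_apply, transformCoeff_apply, ← h]
  push_cast
  rfl

lemma invSqrtCoeff_sq_add_transformCoeff_sq :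
    invSqrtCoeff * invSqrtCoeff + transformCoeff * transformCoeff = 1 :=
  DFunLike.ext _ _ fun k => by
    change (Real.cos (Real.arctan k) : ℂ) * Real.cos (Real.arctan k)
      + Real.sin (Real.arctan k) * Real.sin (Real.arctan k) = 1
    norm_cast
    linarith [Real.cos_sq_add_sin_sq (Real.arctan k)]

lemma invSqrtCoeff_sq_mul (k : ℤ) : invSqrtCoeff k ^ 2 * (1 + (k : ℂ) ^ 2) = 1 := by
  have h : invSqrtCoeff k * invSqrtCoeff k + transformCoeff k * transformCoeff k = 1 :=
    DFunLike.congr_fun invSqrtCoeff_sq_add_transformCoeff_sq k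
  rw [← intCast_mul_invSqrtCoeff] at h
  linear_combination h

lemma tendsto_cos_arctan_atTop :
    Filter.Tendsto (fun x => Real.cos (Real.arctan x)) Filter.atTop (nhds 0) := by
  simpa only [Real.cos_pi_div_two, Function.comp_def] using (Real.continuous_cos.tendsto _).comp
    (tendsto_nhds_of_tendsto_nhdsWithin Real.tendsto_arctan_atTop)

lemma tendsto_cos_arctan_atBot :
    Filter.Tendsto (fun x => Real.cos (Real.arctan x)) Filter.atBot (nhds 0) := by
  simpa only [Real.cos_neg, Real.cos_pi_div_two, Function.comp_def] using
    (Real.continuous_cos.tendsto _).comp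
      (tendsto_nhds_of_tendsto_nhdsWithin Real.tendsto_arctan_atBot)

lemma tendsto_sin_arctan_atTop :
    Filter.Tendsto (fun x => Real.sin (Real.arctan x)) Filter.atTop (nhds 1) := by
  simpa only [Real.sin_pi_div_two, Function.comp_def] using (Real.continuous_sin.tendsto _).comp
    (tendsto_nhds_of_tendsto_nhdsWithin Real.tendsto_arctan_atTop)

lemma tendsto_sin_arctan_atBot :
    Filter.Tendsto (fun x => Real.sin (Real.arctan x)) Filter.atBot (nhds (-1)) := by
  simpa only [Real.sin_neg, Real.sin_pi_div_two, Function.comp_def] using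
    (Real.continuous_sin.tendsto _).comp
      (tendsto_nhds_of_tendsto_nhdsWithin Real.tendsto_arctan_atBot)

lemma tendsto_invSqrtCoeff : Filter.Tendsto invSqrtCoeff Filter.cofinite (nhds 0) := by
  rw [← Complex.ofReal_zero, Int.cofinite_eq]
  exact (Complex.continuous_ofReal.tendsto 0).comp
    ((tendsto_cos_arctan_atBot.comp (tendsto_intCast_atBot_iff.2 Filter.tendsto_id)).sup
      (tendsto_cos_arctan_atTop.comp tendsto_intCast_atTop_atTop))

lemma tendsto_transformCoeff_add_sub (n : ℤ) :
    Filter.Tendsto (fun k => transformCoeff (k + n) - transformCoeff k) Filter.cofinite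
      (nhds 0) := by
  have h_bot := tendsto_sin_arctan_atBot.comp
    (tendsto_intCast_atBot_iff (R := ℝ).2 Filter.tendsto_id)
  have h_top := tendsto_sin_arctan_atTop.comp (tendsto_intCast_atTop_atTop (R := ℝ))
  have h_sub : Filter.Tendsto
      (fun k : ℤ => Real.sin (Real.arctan (k + n : ℤ)) - Real.sin (Real.arctan k))
      Filter.cofinite (nhds 0) := by
    rw [Int.cofinite_eq]
    refine .sup ?_ ?_
    · simpa only [sub_self, Function.comp_def, id_eq] using
        (h_bot.comp (Filter.tendsto_atBot_add_const_right _ n Filter.tendsto_id)).sub h_bot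
    · simpa only [sub_self, Function.comp_def, id_eq] using
        (h_top.comp (Filter.tendsto_atTop_add_const_right _ n Filter.tendsto_id)).sub h_top
  simpa only [transformCoeff_apply, ← Complex.ofReal_sub, Complex.ofReal_zero,
    Function.comp_def] using (Complex.continuous_ofReal.tendsto 0).comp h_sub

variable {B : Type v} [NonUnitalCStarAlgebra B] {Y : Type w} [NormedAddCommGroup Y]
  [NormedSpace ℂ Y] [HilbertModule B Y]

namespace IsGrading

variable {P : ℤ → Y →ₗ[ℂ] Y} (hP : IsGrading B P)

include hP

lemma proj_weightedSum (x : (weightedSum B P hP.orthogonal).domain) (k : ℤ) :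
    P k (weightedSum B P hP.orthogonal x) = (k : ℂ) • P k x := by
  have h := (summable_of_mem_weightedDomain hP.orthogonal x.2).hasSum.mapL (hP.proj k)
  refine h.unique ?_
  convert hasSum_single k fun l hl => ?_ using 1
  · rw [map_smul, proj_apply, hP.proj_self]
  · rw [map_smul, proj_apply, hP.proj_of_ne k l hl.symm, smul_zero]

lemma mem_domain_weightedSum {x y : Y} (h : ∀ k : ℤ, P k y = (k : ℂ) • P k x) :
    x ∈ (weightedSum B P hP.orthogonal).domain := by
  refine mem_weightedDomain.2 ((hP.summable_inner y).congr fun k => ?_)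
  rw [h, PreHilbertModule.inner_smul_left, PreHilbertModule.inner_smul_right, smul_smul,
    ← Complex.coe_smul, star_intCast, Complex.ofReal_pow, Complex.ofReal_intCast, pow_two]

lemma exists_weightedSum_eq {x y : Y} (h : ∀ k : ℤ, P k y = (k : ℂ) • P k x) :
    ∃ hx : x ∈ (weightedSum B P hP.orthogonal).domain,
      weightedSum B P hP.orthogonal ⟨x, hx⟩ = y :=
  ⟨hP.mem_domain_weightedSum h, hP.ext fun k => by rw [hP.proj_weightedSum, h]⟩

lemma exists_weightedSum_diag_invSqrtCoeff_eq (x : Y) :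
    ∃ hx : hP.diag invSqrtCoeff x ∈ (weightedSum B P hP.orthogonal).domain,
      weightedSum B P hP.orthogonal ⟨hP.diag invSqrtCoeff x, hx⟩ = hP.diag transformCoeff x :=
  hP.exists_weightedSum_eq fun k => by
    rw [proj_diag, proj_diag, smul_smul, intCast_mul_invSqrtCoeff]

lemma exists_weightedSum_proj_eq (k : ℤ) (x : Y) :
    ∃ hx : P k x ∈ (weightedSum B P hP.orthogonal).domain,
      weightedSum B P hP.orthogonal ⟨P k x, hx⟩ = (k : ℂ) • P k x :=
  hP.exists_weightedSum_eq fun l => by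
    rw [map_smul]
    obtain rfl | hkl := eq_or_ne l k
    · rfl
    · rw [hP.proj_of_ne l k hkl, smul_zero, smul_zero]

lemma isInvSqrtOneAddSq_diag :
    IsInvSqrtOneAddSq B (weightedSum B P hP.orthogonal) (hP.diag invSqrtCoeff) where
  nonneg x := by
    obtain ⟨d, hd⟩ := exists_star_mul_self_eq_invSqrtCoeff
    rw [← hd]
    exact hP.exists_inner_diag_eq_star_mul_self d x
  right_inv x := by
    obtain ⟨h, hDR⟩ := hP.exists_weightedSum_diag_invSqrtCoeff_eq (hP.diag invSqrtCoeff x)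
    obtain ⟨h', hDT⟩ := hP.exists_weightedSum_diag_invSqrtCoeff_eq (hP.diag transformCoeff x)
    have h_comm : hP.diag transformCoeff (hP.diag invSqrtCoeff x)
        = hP.diag invSqrtCoeff (hP.diag transformCoeff x) := by
      rw [← mul_apply_eq_comp, ← mul_apply_eq_comp, ← diag_mul, ← diag_mul, mul_comm]
    have h_sq : hP.diag invSqrtCoeff * hP.diag invSqrtCoeff
        + hP.diag transformCoeff * hP.diag transformCoeff = 1 := by
      rw [← diag_mul, ← diag_mul, ← diag_add, invSqrtCoeff_sq_add_transformCoeff_sq, diag_one]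
    have hDR' := hDR.trans h_comm
    refine ⟨h, hDR'.symm ▸ h', ?_⟩
    simp only [hDR', hDT]
    exact DFunLike.congr_fun h_sq x
  left_inv x h := hP.ext fun k => by
    rw [hP.proj_diag, hP.proj_diag, map_add, hP.proj_weightedSum, hP.proj_weightedSum, smul_smul,
      smul_smul, ← one_smul ℂ (P k (x : Y)), smul_smul, ← add_smul, smul_smul, ← pow_two,
      ← pow_two, mul_one, invSqrtCoeff_sq_mul]

lemma sq_apply_proj_of_isInvSqrtOneAddSq {R : Y →L[ℂ] Y}
    (hR : IsInvSqrtOneAddSq B (weightedSum B P hP.orthogonal) R) (k : ℤ) (x : Y) :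
    R (R (P k x)) = invSqrtCoeff k ^ 2 • P k x := by
  set D := weightedSum B P hP.orthogonal
  obtain ⟨h_mem, h_eq⟩ := hP.exists_weightedSum_proj_eq k x
  have h_mem' : D ⟨P k x, h_mem⟩ ∈ D.domain := by
    rw [h_eq]
    exact Submodule.smul_mem _ _ h_mem
  have h_eq' : D ⟨D ⟨P k x, h_mem⟩, h_mem'⟩ = (k : ℂ) ^ 2 • P k x := by
    have h : (⟨D ⟨P k x, h_mem⟩, h_mem'⟩ : D.domain) = (k : ℂ) • ⟨P k x, h_mem⟩ :=
      Subtype.ext h_eq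
    rw [h, LinearPMap.map_smul, h_eq, smul_smul, pow_two]
  have h_inv : (1 + (k : ℂ) ^ 2) • R (R (P k x)) = P k x := by
    rw [← map_smul, ← map_smul, add_smul, one_smul, ← h_eq']
    exact hR.left_inv ⟨P k x, h_mem⟩ h_mem'
  conv_rhs => rw [← h_inv, smul_smul, invSqrtCoeff_sq_mul, one_smul]

lemma eq_diag_of_isInvSqrtOneAddSq {R : Y →L[ℂ] Y}
    (hR : IsInvSqrtOneAddSq B (weightedSum B P hP.orthogonal) R) : R = hP.diag invSqrtCoeff :=
  hP.ext_clm fun k x => by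
    rw [diag_proj]
    exact HilbertModule.eq_smul_of_sq_eq hR.nonneg (Real.cos_arctan_pos k)
      (hP.sq_apply_proj_of_isInvSqrtOneAddSq hR k x)

theorem isBoundedTransform_iff {T : Y →L[ℂ] Y} :
    IsBoundedTransform B (weightedSum B P hP.orthogonal) T ↔ T = hP.diag transformCoeff := by
  constructor
  · rintro ⟨R, hR, hT⟩
    obtain rfl := hP.eq_diag_of_isInvSqrtOneAddSq hR
    refine ContinuousLinearMap.ext fun x => ?_
    obtain ⟨_, h_eq⟩ := hT x
    obtain ⟨_, h_eq'⟩ := hP.exists_weightedSum_diag_invSqrtCoeff_eq x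
    rw [← h_eq, ← h_eq']
  · rintro rfl
    exact ⟨_, hP.isInvSqrtOneAddSq_diag, hP.exists_weightedSum_diag_invSqrtCoeff_eq⟩

end IsGrading

end BoundedTransform

section Eigenvectors

section FourierCoefficients

variable {T : ℝ} [Fact (0 < T)]

lemma eq_zero_of_fourierCoeff_eq_zero {f : C(AddCircle T, ℂ)} (h : ∀ n, fourierCoeff f n = 0) :
    f = 0 := by
  have h_zero : fourierCoeff f = 0 := funext h
  have h_sum := hasSum_fourier_series_of_summable (f := f) (h_zero ▸ summable_zero)
  simp only [h, zero_smul] at h_sum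
  exact h_sum.unique hasSum_zero

variable {Y Z : Type*} [NormedAddCommGroup Y] [NormedSpace ℂ Y] [NormedAddCommGroup Z]
  [NormedSpace ℂ Z]

lemma map_fourierCoeff [CompleteSpace Y] [CompleteSpace Z] (L : Y →L[ℂ] Z) {f : AddCircle T → Y}
    (hf : Continuous f) (n : ℤ) : L (fourierCoeff f n) = fourierCoeff (fun t => L (f t)) n := by
  have h_integrable : MeasureTheory.Integrable (fun t => fourier (-n) t • f t)
      AddCircle.haarAddCircle :=
    ((fourier (-n)).continuous.smul hf).integrable_of_hasCompactSupport
      (HasCompactSupport.of_compactSpace _)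
  rw [fourierCoeff, ← L.integral_comp_comm h_integrable]
  exact MeasureTheory.integral_congr_ae (.of_forall fun t => L.map_smul _ _)

lemma fourierCoeff_comp_add_left (f : AddCircle T → Y) (s : AddCircle T) (n : ℤ) :
    fourierCoeff (fun t => f (s + t)) n = ((s.toCircle : ℂ) ^ n) • fourierCoeff f n := by
  have h_char (t : AddCircle T) :
      fourier (-n) t = ((s.toCircle : ℂ) ^ n) * fourier (-n) (s + t) := by
    change ((-n • t).toCircle : ℂ) = ((s.toCircle : ℂ) ^ n) * ((-n • (s + t)).toCircle : Circle)
    rw [smul_add, AddCircle.toCircle_add, AddCircle.toCircle_zsmul s, Circle.coe_mul,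
      Circle.coe_zpow, ← mul_assoc, ← zpow_add₀ (Circle.coe_ne_zero _), add_neg_cancel, zpow_zero,
      one_mul]
  rw [fourierCoeff, fourierCoeff,
    ← MeasureTheory.integral_add_left_eq_self (fun t => fourier (-n) t • f t) s,
    ← MeasureTheory.integral_smul]
  refine MeasureTheory.integral_congr_ae (.of_forall fun t => ?_)
  simp only [h_char t, mul_smul]

end FourierCoefficients

variable {Y : Type*} [NormedAddCommGroup Y] [NormedSpace ℂ Y] [CompleteSpace Y]
  {U : Circle →* (Y →L[ℂ] Y)}

lemma apply_fourierCoeff_orbit {x : Y} (hx : Continuous fun z => U z x) (n : ℤ) (z : Circle) :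
    U z (fourierCoeff (fun t : UnitAddCircle => U t.toCircle x) n)
      = ((z : ℂ) ^ n) • fourierCoeff (fun t : UnitAddCircle => U t.toCircle x) n := by
  obtain ⟨s, rfl⟩ : ∃ s : UnitAddCircle, s.toCircle = z :=
    ⟨(AddCircle.homeomorphCircle one_ne_zero).symm z, by
      rw [← AddCircle.homeomorphCircle_apply one_ne_zero, Homeomorph.apply_symm_apply]⟩
  have h_orbit : Continuous fun t : UnitAddCircle => U t.toCircle x :=
    hx.comp AddCircle.continuous_toCircle
  have h_add (t : UnitAddCircle) : U s.toCircle (U t.toCircle x) = U (s + t).toCircle x := by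
    rw [AddCircle.toCircle_add, map_mul, mul_apply_eq_comp]
  simp only [map_fourierCoeff _ h_orbit, h_add]
  exact fourierCoeff_comp_add_left (fun t : UnitAddCircle => U t.toCircle x) s n

/- By Hahn-Banach it suffices that a functional `φ` killing all eigenvectors kills every `x`: the
Fourier coefficients of the continuous function `t ↦ φ (U_t x)` are values of `φ` at
eigenvectors. -/
theorem dense_span_eigenvectors (hU : ∀ x, Continuous fun z => U z x) :
    Dense (Submodule.span ℂ {x : Y | ∃ n : ℤ, ∀ z, U z x = ((z : ℂ) ^ n) • x} : Set Y) := by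
  set M := Submodule.span ℂ {x : Y | ∃ n : ℤ, ∀ z, U z x = ((z : ℂ) ^ n) • x}
  have : IsClosed (M.topologicalClosure : Set Y) := M.isClosed_topologicalClosure
  refine fun x => (Submodule.Quotient.mk_eq_zero M.topologicalClosure).1 ?_
  refine SeparatingDual.eq_zero_of_forall_dual_eq_zero (R := ℂ) fun φ => ?_
  let ψ : Y →L[ℂ] ℂ := φ ∘L M.topologicalClosure.mkQL
  have hψ : ∀ y ∈ M, ψ y = 0 := fun y hy => by
    change φ (Submodule.Quotient.mk y) = 0
    rw [(Submodule.Quotient.mk_eq_zero _).2 (M.le_topologicalClosure hy), map_zero]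
  have h_orbit : Continuous fun t : UnitAddCircle => U t.toCircle x :=
    (hU x).comp AddCircle.continuous_toCircle
  have h_zero : (⟨fun t => ψ (U t.toCircle x), ψ.continuous.comp h_orbit⟩ :
      C(UnitAddCircle, ℂ)) = 0 := eq_zero_of_fourierCoeff_eq_zero fun n => by
    rw [ContinuousMap.coe_mk, ← map_fourierCoeff ψ h_orbit]
    exact hψ _ (Submodule.subset_span ⟨n, apply_fourierCoeff_orbit (hU x) n⟩)
  have h_apply := DFunLike.congr_fun h_zero (0 : UnitAddCircle)
  rwa [ContinuousMap.coe_mk, AddCircle.toCircle_zero, map_one] at h_apply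

end Eigenvectors

namespace CircleAction

open UniformSpace PreHilbertModule HilbertModule

variable {A : Type v} [NonUnitalCStarAlgebra A] (α : CircleAction A)

/-- The elements of degree `n`, on which the circle acts through the character `z ↦ zⁿ`. -/
def IsHomogeneous (n : ℤ) (a : A) : Prop := ∀ z, α.act z a = ((z : ℂ) ^ n) • a

namespace IsHomogeneous

variable {α}

lemma mul {m n : ℤ} {a b : A} (ha : α.IsHomogeneous m a) (hb : α.IsHomogeneous n b) :
    α.IsHomogeneous (m + n) (a * b) := fun z => by
  rw [map_mul, ha, hb, smul_mul_smul_comm, zpow_add₀ (Circle.coe_ne_zero z)]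

lemma star {n : ℤ} {a : A} (ha : α.IsHomogeneous n a) : α.IsHomogeneous (-n) (star a) :=
  fun z => by
    rw [map_star, ha, star_smul, Complex.star_def, map_zpow₀, ← Circle.coe_inv_eq_conj,
      Circle.coe_inv, inv_zpow']

end IsHomogeneous

lemma dense_span_isHomogeneous :
    Dense (Submodule.span ℂ {a | ∃ n, α.IsHomogeneous n a} : Set A) :=
  dense_span_eigenvectors
    (U := { toFun := α.actCLM
            map_one' := ContinuousLinearMap.ext α.act_one
            map_mul' := fun z w => ContinuousLinearMap.ext (α.act_mul z w) })
    α.continuous_act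

lemma unitary_toX (z : Circle) (a : A) : α.unitary z (α.toX a) = α.toX (α.act z a) :=
  complMap_coe _ _

lemma leftMul_toX (a b : A) : α.leftMul a (α.toX b) = α.toX (a * b) :=
  α.complMap_preLeftMul a b

lemma inner_toX (a b : A) : inner α.fixed (α.toX a) (α.toX b) = α.expectation (star a * b) :=
  compl_inner_coe _ _

lemma ract_toX (a : A) (b : α.fixed) : ract (α.toX a) b = α.toX (a * b) :=
  complMap_coe (ractCLM b) _

lemma norm_leftMul_le (a : A) : ‖α.leftMul a‖ ≤ ‖a‖ := by
  refine ContinuousLinearMap.opNorm_le_bound _ (norm_nonneg a) fun x => ?_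
  refine Completion.induction_on x (isClosed_le (α.leftMul a).continuous.norm
    (continuous_const.mul continuous_norm)) fun b => ?_
  obtain ⟨b, rfl⟩ := Pre.of.surjective b
  change ‖α.leftMul a (α.toX b)‖ ≤ ‖a‖ * ‖α.toX b‖
  rw [leftMul_toX, toX, toX, Completion.norm_coe, Completion.norm_coe]
  exact α.norm_of_mul_le a b

lemma continuous_leftMul : Continuous α.leftMul :=
  AddMonoidHomClass.continuous_of_bound α.leftMul 1 fun a => by
    rw [one_mul]
    exact α.norm_leftMul_le a

lemma isAdjointPair_leftMul (a : A) :
    IsAdjointPair α.fixed (α.leftMul a) (α.leftMul (star a)) := fun x y => by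
  refine Completion.induction_on₂ x y (isClosed_eq ?_ ?_) fun b c => ?_
  · exact Continuous.compl_inner ((α.leftMul a).continuous.comp continuous_fst) continuous_snd
  · exact Continuous.compl_inner continuous_fst
      ((α.leftMul (star a)).continuous.comp continuous_snd)
  · obtain ⟨b, rfl⟩ := Pre.of.surjective b
    obtain ⟨c, rfl⟩ := Pre.of.surjective c
    change inner α.fixed (α.leftMul a (α.toX b)) (α.toX c)
      = inner α.fixed (α.toX b) (α.leftMul (star a) (α.toX c))
    rw [leftMul_toX, leftMul_toX, inner_toX, inner_toX, star_mul, mul_assoc]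

lemma unitary_leftMul (z : Circle) (a : A) (x : α.X) :
    α.unitary z (α.leftMul a x) = α.leftMul (α.act z a) (α.unitary z x) := by
  have h : α.unitary z * α.leftMul a = α.leftMul (α.act z a) * α.unitary z := α.X_ext fun b => by
    rw [mul_apply_eq_comp, mul_apply_eq_comp, leftMul_toX, unitary_toX, unitary_toX, leftMul_toX,
      map_mul]
  exact DFunLike.congr_fun h x

lemma norm_spectralProj_le (k : ℤ) (x : α.X) : ‖α.spectralProj k x‖ ≤ ‖x‖ := by
  have h : ‖∫ θ in (0 : ℝ)..2 * Real.pi,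
      ((Circle.exp θ : ℂ) ^ (-k)) • α.unitary (Circle.exp θ) x‖ ≤ ‖x‖ * |2 * Real.pi - 0| :=
    intervalIntegral.norm_integral_le_of_norm_le_const fun θ _ => by
      rw [norm_smul, norm_zpow, Circle.norm_coe, one_zpow, one_mul, norm_unitary]
  rw [sub_zero, abs_of_pos Real.two_pi_pos] at h
  rw [spectralProj_apply, norm_smul, norm_inv, Real.norm_of_nonneg Real.two_pi_pos.le,
    inv_mul_le_iff₀ Real.two_pi_pos, mul_comm _ ‖x‖]
  exact h

lemma unitary_apply_spectralProj (k : ℤ) (z : Circle) (x : α.X) :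
    α.unitary z (α.spectralProj k x) = ((z : ℂ) ^ k) • α.spectralProj k x := by
  rw [← Circle.exp_arg z]
  exact α.unitary_spectralProj k _ x

lemma spectralProj_eq_self {k : ℤ} {x : α.X} (h : ∀ z, α.unitary z x = ((z : ℂ) ^ k) • x) :
    α.spectralProj k x = x := by
  have h_const (θ : ℝ) : ((Circle.exp θ : ℂ) ^ (-k)) • α.unitary (Circle.exp θ) x = x := by
    rw [h, smul_smul, ← zpow_add₀ (Circle.coe_ne_zero _), neg_add_cancel, zpow_zero, one_smul]
  simp only [spectralProj_apply, h_const]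
  rw [intervalIntegral.integral_const, sub_zero, smul_smul,
    inv_mul_cancel₀ Real.two_pi_pos.ne', one_smul]

lemma spectralProj_eq_zero {k n : ℤ} (hkn : k ≠ n) {x : α.X}
    (h : ∀ z, α.unitary z x = ((z : ℂ) ^ n) • x) : α.spectralProj k x = 0 := by
  obtain ⟨c, hc⟩ : ∃ c : ℂ, α.spectralProj k x = c • x := by
    refine ⟨(2 * Real.pi)⁻¹ • ∫ θ in (0 : ℝ)..2 * Real.pi,
      ((Circle.exp θ : ℂ) ^ (-k)) * ((Circle.exp θ : ℂ) ^ n), ?_⟩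
    rw [spectralProj_apply, smul_assoc, ← intervalIntegral.integral_smul_const]
    simp only [h, smul_smul]
  refine eq_zero_of_inner_self (B := α.fixed) ?_
  have h_orthogonal := α.inner_spectralProj_of_ne hkn x x
  rw [α.spectralProj_eq_self h] at h_orthogonal
  nth_rewrite 2 [hc]
  rw [PreHilbertModule.inner_smul_right, h_orthogonal, smul_zero]

theorem isGrading : IsGrading α.fixed α.spectralProj where
  orthogonal _ _ h x y := α.inner_spectralProj_of_ne h x y
  proj_self k x := α.spectralProj_eq_self (α.unitary_apply_spectralProj k · x)
  proj_of_ne k l hkl x := α.spectralProj_eq_zero hkl (α.unitary_apply_spectralProj l · x)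
  norm_le := α.norm_spectralProj_le
  dense := by
    have h_one : α.unitary 1 = 1 := α.X_ext fun a => by
      rw [unitary_toX, act_one, one_apply_eq_self]
    refine (dense_span_eigenvectors
      (U := { toFun := α.unitary
              map_one' := h_one
              map_mul' := fun z w => ContinuousLinearMap.ext (α.unitary_mul z w) })
      α.continuous_unitary).mono (Submodule.span_mono ?_)
    rintro x ⟨k, hx⟩
    exact ⟨k, x, (α.spectralProj_eq_self hx).symm⟩

lemma spectralProj_leftMul {n : ℤ} {a : A} (ha : α.IsHomogeneous n a) (k : ℤ) (x : α.X) :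
    α.spectralProj (k + n) (α.leftMul a x) = α.leftMul a (α.spectralProj k x) := by
  have h_integrand (θ : ℝ) : ((Circle.exp θ : ℂ) ^ (-(k + n)))
        • α.unitary (Circle.exp θ) (α.leftMul a x)
      = α.leftMul a (((Circle.exp θ : ℂ) ^ (-k)) • α.unitary (Circle.exp θ) x) := by
    rw [unitary_leftMul, ha, map_smul, map_smul, smul_apply, smul_smul,
      ← zpow_add₀ (Circle.coe_ne_zero _), neg_add, neg_add_cancel_right]
  simp only [spectralProj_apply, h_integrand]
  rw [← Complex.coe_smul, ← Complex.coe_smul, map_smul]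
  exact congrArg _ ((α.leftMul a).intervalIntegral_comp_comm
    ((α.continuous_integrand k x).intervalIntegrable _ _))

/-- The canonical map `A → X` as a bounded linear map. -/
noncomputable def toXCLM : A →L[ℂ] α.X :=
  LinearMap.mkContinuous { toFun := α.toX, map_add' := α.toX_add, map_smul' := α.toX_smul } 1
    fun a => by rw [one_mul]; exact α.norm_toX_le a

lemma toXCLM_apply (a : A) : α.toXCLM a = α.toX a := rfl

lemma denseRange_toXCLM : DenseRange α.toXCLM :=
  (Completion.denseRange_coe : DenseRange ((↑) : Pre α.fixed A → α.X))

lemma spectralProj_toX_eq_zero {k n : ℤ} (hkn : k ≠ n) {a : A} (ha : α.IsHomogeneous n a) :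
    α.spectralProj k (α.toX a) = 0 :=
  α.spectralProj_eq_zero hkn fun z => by rw [unitary_toX, ha, toX_smul]

lemma spectralProj_zero_toX (a : A) : α.spectralProj 0 (α.toX a) = α.toX (α.average a) := by
  simp only [spectralProj_apply, neg_zero, zpow_zero, one_smul, unitary_toX, average]
  rw [← toXCLM_apply, ← Complex.coe_smul, ← Complex.coe_smul, map_smul]
  exact congrArg _ (α.toXCLM.intervalIntegral_comp_comm
    ((α.continuous_act_exp a).intervalIntegrable _ _))

lemma rankOne_toX (a : A) {n : ℤ} {b : A} (hb : α.IsHomogeneous n b) :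
    rankOne α.fixed (α.toX a) (α.toX b) = α.leftMul (a * star b) * α.isGrading.proj n :=
  α.X_ext fun c => by
    have h := α.spectralProj_leftMul hb.star n (α.toX c)
    rw [add_neg_cancel, leftMul_toX, spectralProj_zero_toX] at h
    rw [rankOne_apply, inner_toX, ract_toX, mul_apply_eq_comp, IsGrading.proj_apply, map_mul,
      mul_apply_eq_comp, ← h, leftMul_toX]
    rfl

/-- The closed left ideal of all `a` for which `a Φ_k` is a compact endomorphism of `X`. -/
noncomputable def compactIdeal (k : ℤ) : Submodule ℂ A :=
  (compactEndomorphisms α.fixed α.X).comap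
    (LinearMap.mulRight ℂ (α.isGrading.proj k) ∘ₗ (α.leftMul : A →ₗ[ℂ] (α.X →L[ℂ] α.X)))

variable {α}

lemma mem_compactIdeal {k : ℤ} {a : A} : a ∈ α.compactIdeal k ↔
    α.leftMul a * α.isGrading.proj k ∈ compactEndomorphisms α.fixed α.X := Iff.rfl

lemma isClosed_compactIdeal (k : ℤ) : IsClosed (α.compactIdeal k : Set A) :=
  compactEndomorphisms.isClosed.preimage (α.continuous_leftMul.mul continuous_const)

lemma mul_mem_compactIdeal {k : ℤ} (a : A) {b : A} (hb : b ∈ α.compactIdeal k) :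
    a * b ∈ α.compactIdeal k := by
  rw [mem_compactIdeal, map_mul, mul_assoc]
  exact compactEndomorphisms.mul_mem_left (α.isAdjointPair_leftMul a) hb

lemma mul_homogeneous_mem_compactIdeal {n k : ℤ} {a b : A} (hb : α.IsHomogeneous n b)
    (ha : a ∈ α.compactIdeal (k + n)) : a * b ∈ α.compactIdeal k := by
  have h : α.leftMul b * α.isGrading.proj k = α.isGrading.proj (k + n) * α.leftMul b :=
    ContinuousLinearMap.ext fun x => (α.spectralProj_leftMul hb k x).symm
  rw [mem_compactIdeal, map_mul, mul_assoc, h, ← mul_assoc]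
  exact compactEndomorphisms.mul_mem_right (α.isAdjointPair_leftMul b) ha

lemma mul_star_mem_compactIdeal (a : A) {n : ℤ} {b : A} (hb : α.IsHomogeneous n b) :
    a * star b ∈ α.compactIdeal n := by
  rw [mem_compactIdeal, ← α.rankOne_toX a hb]
  exact compactEndomorphisms.rankOne_mem _ _

lemma mem_compactIdeal_of_spectralProj_eq_zero {k : ℤ} {a : A} (ha : α.IsHomogeneous 0 a)
    (h : ∀ b, α.spectralProj k (α.toX (a * b)) = 0) : a ∈ α.compactIdeal k := by
  have h_zero : α.leftMul a * α.isGrading.proj k = 0 := α.X_ext fun b => by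
    rw [mul_apply_eq_comp, IsGrading.proj_apply, ← α.spectralProj_leftMul ha, add_zero,
      leftMul_toX, h, zero_apply]
  rw [mem_compactIdeal, h_zero]
  exact Submodule.zero_mem _

lemma commutator_diag_leftMul (c : ℤ →ᵇ ℂ) {n : ℤ} {a : A} (ha : α.IsHomogeneous n a) :
    α.isGrading.diag c * α.leftMul a - α.leftMul a * α.isGrading.diag c = α.leftMul a *
      α.isGrading.diag (c.compContinuous ⟨(· + n), continuous_of_discreteTopology⟩ - c) := by
  refine α.isGrading.ext_clm fun k x => ?_
  simp only [sub_apply, mul_apply_eq_comp, ← α.spectralProj_leftMul ha, IsGrading.diag_proj,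
    map_smul]
  exact (sub_smul _ _ _).symm

lemma commutator_diag_leftMul_mem {c : ℤ →ᵇ ℂ}
    (hc : ∀ n, Filter.Tendsto (fun k => c (k + n) - c k) Filter.cofinite (nhds 0))
    (h : ∀ a k, a ∈ α.compactIdeal k) (a : A) :
    α.isGrading.diag c * α.leftMul a - α.leftMul a * α.isGrading.diag c
      ∈ compactEndomorphisms α.fixed α.X := by
  let M : Submodule ℂ A := (compactEndomorphisms α.fixed α.X).comap
    ((LinearMap.mulLeft ℂ (α.isGrading.diag c) - LinearMap.mulRight ℂ (α.isGrading.diag c)) ∘ₗ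
      (α.leftMul : A →ₗ[ℂ] (α.X →L[ℂ] α.X)))
  have hM_closed : IsClosed (M : Set A) := compactEndomorphisms.isClosed.preimage
    ((continuous_const.mul α.continuous_leftMul).sub (α.continuous_leftMul.mul continuous_const))
  have hM_homogeneous : {a | ∃ n, α.IsHomogeneous n a} ⊆ (M : Set A) := by
    rintro b ⟨n, hb⟩
    change α.isGrading.diag c * α.leftMul b - α.leftMul b * α.isGrading.diag c
      ∈ compactEndomorphisms α.fixed α.X
    rw [commutator_diag_leftMul c hb]
    exact α.isGrading.mul_diag_mem_compactEndomorphisms (h b) (hc n)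
  exact hM_closed.closure_subset_iff.2 (Submodule.span_le.2 hM_homogeneous)
    (α.dense_span_isHomogeneous a)

theorem isOddKasparovModule_diag_transformCoeff (hX : IsCountablyGenerated α.fixed α.X)
    (h : ∀ a k, a ∈ α.compactIdeal k) :
    IsOddKasparovModule α.fixed α.leftMul (α.isGrading.diag transformCoeff) where
  countablyGenerated := hX
  isAdjointPair := α.isAdjointPair_leftMul
  exists_adjoint := ⟨_, α.isGrading.isAdjointPair_diag _⟩
  sub_adjoint S hS a := by
    obtain rfl := (α.isGrading.isAdjointPair_diag _).eq hS
    rw [star_transformCoeff, sub_self, mul_zero]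
    exact Submodule.zero_mem _
  sq_sub_one a := by
    have h_sq : α.isGrading.diag transformCoeff * α.isGrading.diag transformCoeff - 1
        = -α.isGrading.diag (invSqrtCoeff * invSqrtCoeff) := by
      rw [sub_eq_iff_eq_add, eq_neg_add_iff_add_eq, ← IsGrading.diag_mul, ← IsGrading.diag_add,
        invSqrtCoeff_sq_add_transformCoeff_sq, IsGrading.diag_one]
    have h_tendsto := tendsto_invSqrtCoeff.mul tendsto_invSqrtCoeff
    rw [mul_zero] at h_tendsto
    rw [h_sq, mul_neg]
    exact Submodule.neg_mem _
      (α.isGrading.mul_diag_mem_compactEndomorphisms (h a) h_tendsto)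
  commutator := commutator_diag_leftMul_mem tendsto_transformCoeff_add_sub h

end CircleAction

lemma countable_closure_subsemigroup {M : Type*} [Semigroup M] {s : Set M} (hs : s.Countable) :
    (Subsemigroup.closure s : Set M).Countable := by
  have := hs.to_subtype
  have h_injective : Function.Injective fun w : FreeSemigroup s => (w.head, w.tail) := by
    rintro ⟨a, l⟩ ⟨b, m⟩ h
    simpa using h
  have : Countable (FreeSemigroup s) := h_injective.countable
  have h : Subsemigroup.closure s ≤ (FreeSemigroup.lift (Subtype.val : s → M)).srange :=
    Subsemigroup.closure_le.2 fun a ha => ⟨FreeSemigroup.of ⟨a, ha⟩, FreeSemigroup.lift_of _ _⟩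
  exact (Set.countable_range _).mono h

namespace DirectedGraph

variable {V E : Type u} {G : DirectedGraph V E}

variable (G) in
/-- Every vertex emits only finitely many edges. -/
def RowFinite : Prop := ∀ v, {e | G.s e = v}.Finite

namespace CKFamily

variable {B : Type w} [NonUnitalCStarAlgebra B] (f : G.CKFamily B)

lemma star_p (v : V) : star (f.p v) = f.p v := (f.isStarProjection_p v).isSelfAdjoint

lemma p_mul_self (v : V) : f.p v * f.p v = f.p v := (f.isStarProjection_p v).isIdempotentElem

lemma S_mul_p (e : E) : f.S e * f.p (G.r e) = f.S e := by
  rw [← f.star_S_mul_S, ← mul_assoc, f.S_mul_star_mul_S]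

lemma star_S_mul_p_mul_S [DecidableEq E] {e : E} (h : {e' | G.s e' = G.s e}.Finite) :
    star (f.S e) * f.p (G.s e) * f.S e = f.p (G.r e) +
      ∑ e' ∈ h.toFinset.erase e, star (star (f.S e') * f.S e) * (star (f.S e') * f.S e) := by
  have he : e ∈ h.toFinset := h.mem_toFinset.2 rfl
  rw [f.p_eq_sum _ h ⟨e, rfl⟩, Finset.mul_sum, Finset.sum_mul, ← Finset.add_sum_erase _ _ he]
  congr 1
  · rw [← mul_assoc, f.star_S_mul_S, mul_assoc, f.star_S_mul_S, f.p_mul_self]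
  · refine Finset.sum_congr rfl fun e' _ => ?_
    simp only [star_mul, star_star, mul_assoc]

lemma star_mul_self_S_sub_p_mul_S (e : E) :
    star (f.S e - f.p (G.s e) * f.S e) * (f.S e - f.p (G.s e) * f.S e)
      = f.p (G.r e) - star (f.S e) * f.p (G.s e) * f.S e := by
  have h : star (f.S e) * f.p (G.s e) * (f.p (G.s e) * f.S e)
      = star (f.S e) * f.p (G.s e) * f.S e := by
    rw [mul_assoc, ← mul_assoc (f.p _), f.p_mul_self, mul_assoc]
  rw [star_sub, star_mul, f.star_p, sub_mul, mul_sub, mul_sub, f.star_S_mul_S, h, sub_self,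
    sub_zero, mul_assoc]

/- `p_v = ∑ S_{e'} S_{e'}⋆` and the C⋆-identities exhibit a sum of positive elements which is zero,
so that each of them is zero. -/
lemma S_sub_p_mul_S_eq_zero_and_star_S_mul_S_eq_zero {e : E}
    (h : {e' | G.s e' = G.s e}.Finite) : f.S e - f.p (G.s e) * f.S e = 0 ∧
      ∀ e', G.s e' = G.s e → e' ≠ e → star (f.S e') * f.S e = 0 := by
  classical
  let := CStarAlgebra.spectralOrder B
  have := CStarAlgebra.spectralOrderedRing B
  have h_sum := (f.star_mul_self_S_sub_p_mul_S e).trans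
    (congrArg (f.p (G.r e) - ·) (f.star_S_mul_p_mul_S h))
  rw [sub_add_cancel_left, eq_neg_iff_add_eq_zero, add_eq_zero_iff_of_nonneg
    (star_mul_self_nonneg _) (Finset.sum_nonneg fun e' _ => star_mul_self_nonneg _),
    Finset.sum_eq_zero_iff_of_nonneg fun e' _ => star_mul_self_nonneg _] at h_sum
  exact ⟨(CStarRing.star_mul_self_eq_zero_iff _).1 h_sum.1, fun e' hs he =>
    (CStarRing.star_mul_self_eq_zero_iff _).1
      (h_sum.2 e' (Finset.mem_erase.2 ⟨he, h.mem_toFinset.2 hs⟩))⟩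

lemma p_mul_S (hG : G.RowFinite) (e : E) : f.p (G.s e) * f.S e = f.S e :=
  (sub_eq_zero.1 (f.S_sub_p_mul_S_eq_zero_and_star_S_mul_S_eq_zero (hG (G.s e))).1).symm

lemma p_mul_S_of_ne (hG : G.RowFinite) {v : V} {e : E} (h : v ≠ G.s e) : f.p v * f.S e = 0 := by
  rw [← f.p_mul_S hG, ← mul_assoc, f.p_mul_p _ _ h, zero_mul]

lemma star_S_mul_p (hG : G.RowFinite) (e : E) : star (f.S e) * f.p (G.s e) = star (f.S e) := by
  rw [← f.star_p, ← star_mul, f.p_mul_S hG]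

lemma star_S_mul_p_of_ne (hG : G.RowFinite) {v : V} {e : E} (h : v ≠ G.s e) :
    star (f.S e) * f.p v = 0 := by
  rw [← f.star_p, ← star_mul, f.p_mul_S_of_ne hG h, star_zero]

lemma star_S_mul_S_of_ne (hG : G.RowFinite) {e e' : E} (h : e' ≠ e) :
    star (f.S e') * f.S e = 0 := by
  by_cases hs : G.s e' = G.s e
  · exact (f.S_sub_p_mul_S_eq_zero_and_star_S_mul_S_eq_zero (hG (G.s e))).2 e' hs h
  · rw [← f.p_mul_S hG e, ← mul_assoc, f.star_S_mul_p_of_ne hG (Ne.symm hs), zero_mul]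

/-- The products of the elements of a Cuntz–Krieger family and their adjoints. -/
def words : Subsemigroup B :=
  Subsemigroup.closure ((Set.range f.p ∪ Set.range f.S) ∪ star (Set.range f.p ∪ Set.range f.S))

lemma countable_words [Countable V] [Countable E] : (f.words : Set B).Countable := by
  have h := (Set.countable_range f.p).union (Set.countable_range f.S)
  refine countable_closure_subsemigroup (h.union ?_)
  rw [← Set.image_star]
  exact h.image _

variable {f}

lemma words_induction {q : B → Prop} (h_p : ∀ v, q (f.p v)) (h_S : ∀ e, q (f.S e))
    (h_star : ∀ e, q (star (f.S e))) (h_mul : ∀ a b, q a → q b → q (a * b)) {a : B}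
    (ha : a ∈ f.words) : q a := by
  induction ha using Subsemigroup.closure_induction with
  | mem a ha =>
    rcases ha with (⟨v, rfl⟩ | ⟨e, rfl⟩) | (⟨v, hv⟩ | ⟨e, he⟩)
    · exact h_p v
    · exact h_S e
    · rw [← star_star a, ← hv, f.star_p]
      exact h_p v
    · rw [← star_star a, ← he]
      exact h_star e
  | mul a b _ _ ha hb => exact h_mul a b ha hb

lemma exists_mul_p_eq (hG : G.RowFinite) {a : B} (ha : a ∈ f.words) : ∃ v, a * f.p v = a :=
  words_induction (q := fun a => ∃ v, a * f.p v = a) (fun v => ⟨v, f.p_mul_self v⟩)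
    (fun e => ⟨G.r e, f.S_mul_p e⟩) (fun e => ⟨G.s e, f.star_S_mul_p hG e⟩)
    (fun _ _ _ ⟨v, hv⟩ => ⟨v, by rw [mul_assoc, hv]⟩) ha

variable (f) in
/-- The products `p_v S_{e₁}⋆ ⋯ S_{eₙ}⋆` and zero. -/
inductive IsBackwardWord (v : V) : B → Prop
  | zero : IsBackwardWord v 0
  | p : IsBackwardWord v (f.p v)
  | mul_star_S {x : B} (hx : IsBackwardWord v x) (e : E) : IsBackwardWord v (x * star (f.S e))

namespace IsBackwardWord

lemma mul_p (hG : G.RowFinite) {v : V} {x : B} (hx : f.IsBackwardWord v x) (w : V) :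
    f.IsBackwardWord v (x * f.p w) := by
  cases hx with
  | zero =>
    rw [zero_mul]
    exact zero
  | p =>
    rcases eq_or_ne v w with rfl | h
    · rw [f.p_mul_self]
      exact p
    · rw [f.p_mul_p _ _ h]
      exact zero
  | mul_star_S hx e =>
    rw [mul_assoc]
    rcases eq_or_ne w (G.s e) with rfl | h
    · rw [f.star_S_mul_p hG]
      exact hx.mul_star_S e
    · rw [f.star_S_mul_p_of_ne hG h, mul_zero]
      exact zero

lemma mul_S (hG : G.RowFinite) {v : V} (hv : ∀ e, G.s e ≠ v) {x : B}
    (hx : f.IsBackwardWord v x) (e : E) : f.IsBackwardWord v (x * f.S e) := by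
  cases hx with
  | zero =>
    rw [zero_mul]
    exact zero
  | p =>
    rw [f.p_mul_S_of_ne hG (hv e).symm]
    exact zero
  | mul_star_S hx e' =>
    rw [mul_assoc]
    rcases eq_or_ne e' e with rfl | h
    · rw [f.star_S_mul_S]
      exact hx.mul_p hG _
    · rw [f.star_S_mul_S_of_ne hG h, mul_zero]
      exact zero

lemma mul_word (hG : G.RowFinite) {v : V} (hv : ∀ e, G.s e ≠ v) {x a : B}
    (hx : f.IsBackwardWord v x) (ha : a ∈ f.words) : f.IsBackwardWord v (x * a) := by
  refine words_induction (q := fun a => ∀ x, f.IsBackwardWord v x → f.IsBackwardWord v (x * a))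
    (fun w _ hx => hx.mul_p hG w) (fun e _ hx => hx.mul_S hG hv e) (fun e _ hx => hx.mul_star_S e)
    (fun a b ha hb x hx => ?_) ha x hx
  rw [← mul_assoc]
  exact hb _ (ha _ hx)

end IsBackwardWord

end CKFamily

variable (G)

lemma dense_span_words : Dense (Submodule.span ℂ (G.univFamily.words : Set G.Alg) : Set G.Alg) := by
  let T := NonUnitalStarAlgebra.adjoin ℂ (Set.range G.p ∪ Set.range G.S)
  have hT : (T : Set G.Alg) = Submodule.span ℂ (G.univFamily.words : Set G.Alg) :=
    congrArg (fun M : Submodule ℂ G.Alg => (M : Set G.Alg))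
      (NonUnitalStarAlgebra.adjoin_eq_span (Set.range G.p ∪ Set.range G.S))
  have h_generator : ∀ b ∈ Set.range G.p ∪ Set.range G.S, b ∈ T.topologicalClosure := fun b hb =>
    T.le_topologicalClosure (NonUnitalStarAlgebra.subset_adjoin ℂ _ hb)
  rw [← hT]
  exact G.alg_induction (q := fun a => a ∈ T.topologicalClosure)
    T.isClosed_topologicalClosure (fun v => h_generator _ (Or.inl ⟨v, rfl⟩))
    (fun e => h_generator _ (Or.inr ⟨e, rfl⟩)) (zero_mem _) (fun _ _ => add_mem)
    (fun _ _ => mul_mem) (fun c _ => SMulMemClass.smul_mem c) (fun _ => star_mem)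

lemma isCountablyGenerated_X [Countable V] [Countable E] :
    IsCountablyGenerated G.gauge.fixed G.gauge.X := by
  refine ⟨G.gauge.toXCLM '' G.univFamily.words, G.univFamily.countable_words.image _, ?_⟩
  refine (G.gauge.denseRange_toXCLM.dense_image G.gauge.toXCLM.continuous
    G.dense_span_words).mono ?_
  rintro _ ⟨a, ha, rfl⟩
  exact Submodule.span_mono Set.subset_union_left
    (Submodule.apply_mem_span_image_of_mem_span (G.gauge.toXCLM : G.Alg →ₗ[ℂ] G.gauge.X) ha)

lemma isHomogeneous_p (v : V) : G.gauge.IsHomogeneous 0 (G.univFamily.p v) := fun z => by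
  rw [zpow_zero, one_smul]
  exact G.gaugeHom_p z v

lemma isHomogeneous_S (e : E) : G.gauge.IsHomogeneous 1 (G.univFamily.S e) := fun z => by
  rw [zpow_one]
  exact G.gaugeHom_S z e

variable {G}

lemma CKFamily.IsBackwardWord.exists_isHomogeneous {v : V} {x : G.Alg}
    (hx : G.univFamily.IsBackwardWord v x) : ∃ n ≤ 0, G.gauge.IsHomogeneous n x := by
  induction hx with
  | zero => exact ⟨0, le_rfl, fun z => by rw [map_zero, smul_zero]⟩
  | p => exact ⟨0, le_rfl, G.isHomogeneous_p v⟩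
  | mul_star_S _ e ih =>
    obtain ⟨n, hn, hx⟩ := ih
    exact ⟨n + -1, by omega, hx.mul (G.isHomogeneous_S e).star⟩

lemma spectralProj_toX_p_mul_of_sink (hG : G.RowFinite) {v : V} (hv : ∀ e, G.s e ≠ v) {k : ℤ}
    (hk : 0 < k) (a : G.Alg) : G.gauge.spectralProj k (G.gauge.toX (G.univFamily.p v * a)) = 0 := by
  have h : G.gauge.isGrading.proj k ∘L G.gauge.toXCLM ∘L
      ContinuousLinearMap.mul ℂ G.Alg (G.univFamily.p v) = 0 :=
    ContinuousLinearMap.ext_on G.dense_span_words fun b hb => by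
      obtain ⟨n, hn, h_degree⟩ :=
        (CKFamily.IsBackwardWord.p.mul_word hG hv hb).exists_isHomogeneous
      exact G.gauge.spectralProj_toX_eq_zero (by omega) h_degree
  exact DFunLike.congr_fun h a

lemma p_mem_compactIdeal_zero (v : V) : G.univFamily.p v ∈ G.gauge.compactIdeal 0 := by
  rw [← G.univFamily.p_mul_self v]
  nth_rewrite 2 [← G.univFamily.star_p v]
  exact CircleAction.mul_star_mem_compactIdeal _ (G.isHomogeneous_p v)

lemma p_mem_compactIdeal_add_one (hG : G.RowFinite) {k : ℤ} (hk : 0 ≤ k)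
    (h : ∀ v, G.univFamily.p v ∈ G.gauge.compactIdeal k) (v : V) :
    G.univFamily.p v ∈ G.gauge.compactIdeal (k + 1) := by
  by_cases hv : ∃ e, G.s e = v
  · rw [G.univFamily.p_eq_sum v (hG v) hv]
    refine Submodule.sum_mem _ fun e _ => ?_
    refine CircleAction.mul_homogeneous_mem_compactIdeal (G.isHomogeneous_S e).star ?_
    rw [add_neg_cancel_right, ← G.univFamily.S_mul_p]
    exact CircleAction.mul_mem_compactIdeal _ (h _)
  · push Not at hv
    exact CircleAction.mem_compactIdeal_of_spectralProj_eq_zero (G.isHomogeneous_p v)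
      (spectralProj_toX_p_mul_of_sink hG hv (by omega))

lemma p_mem_compactIdeal_sub_one (hG : G.RowFinite) (hs : G.NoSources) {k : ℤ}
    (h : ∀ v, G.univFamily.p v ∈ G.gauge.compactIdeal k) (v : V) :
    G.univFamily.p v ∈ G.gauge.compactIdeal (k - 1) := by
  obtain ⟨e, rfl⟩ := hs v
  rw [← G.univFamily.star_S_mul_S, ← G.univFamily.star_S_mul_p hG]
  refine CircleAction.mul_homogeneous_mem_compactIdeal (G.isHomogeneous_S e) ?_
  rw [sub_add_cancel]
  exact CircleAction.mul_mem_compactIdeal _ (h _)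

lemma p_mem_compactIdeal (hG : G.RowFinite) (hs : G.NoSources) (k : ℤ) :
    ∀ v, G.univFamily.p v ∈ G.gauge.compactIdeal k := by
  induction k using Int.induction_on with
  | zero => exact p_mem_compactIdeal_zero
  | succ n ih => exact p_mem_compactIdeal_add_one hG (Int.natCast_nonneg n) ih
  | pred n ih => exact p_mem_compactIdeal_sub_one hG hs ih

theorem mem_compactIdeal (hG : G.RowFinite) (hs : G.NoSources) (a : G.Alg) (k : ℤ) :
    a ∈ G.gauge.compactIdeal k := by
  have h_words : (G.univFamily.words : Set G.Alg) ⊆ G.gauge.compactIdeal k := fun b hb => by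
    obtain ⟨v, hv⟩ := CKFamily.exists_mul_p_eq hG hb
    rw [← hv]
    exact CircleAction.mul_mem_compactIdeal b (p_mem_compactIdeal hG hs k v)
  exact (CircleAction.isClosed_compactIdeal k).closure_subset_iff.2 (Submodule.span_le.2 h_words)
    (G.dense_span_words a)

end DirectedGraph

end GraphKK

theorem theorem4p6_general {V E : Type u} [Countable V] [Countable E]
    (G : GraphKK.DirectedGraph V E) (hG : G.RowFinite) (hs : G.NoSources) :
    (∃! T : G.gauge.X →L[ℂ] G.gauge.X,
      GraphKK.IsBoundedTransform G.gauge.fixed G.gauge.generator T) ∧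
    ∀ T : G.gauge.X →L[ℂ] G.gauge.X,
      GraphKK.IsBoundedTransform G.gauge.fixed G.gauge.generator T →
        ∃ h : GraphKK.IsOddKasparovModule G.gauge.fixed G.gauge.leftMul T,
          ∃ κ : GraphKK.KK1 G.Alg G.gauge.fixed,
            κ = GraphKK.KK1.classOf G.gauge.leftMul T h := by
  have h_iff {T : G.gauge.X →L[ℂ] G.gauge.X} := G.gauge.isGrading.isBoundedTransform_iff (T := T)
  refine ⟨⟨_, h_iff.2 rfl, fun T hT => h_iff.1 hT⟩, fun T hT => ?_⟩
  obtain rfl := h_iff.1 hT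
  exact ⟨GraphKK.CircleAction.isOddKasparovModule_diag_transformCoeff G.isCountablyGenerated_X
    (GraphKK.DirectedGraph.mem_compactIdeal hG hs), _, rfl⟩

theorem theorem4p6 {V E : Type u} [Countable V] [Countable E] (G : GraphKK.DirectedGraph V E)
    (hG : G.LocallyFinite) (hs : G.NoSources) :
    (∃! T : G.gauge.X →L[ℂ] G.gauge.X,
      GraphKK.IsBoundedTransform G.gauge.fixed G.gauge.generator T) ∧
    ∀ T : G.gauge.X →L[ℂ] G.gauge.X,
      GraphKK.IsBoundedTransform G.gauge.fixed G.gauge.generator T →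
        ∃ h : GraphKK.IsOddKasparovModule G.gauge.fixed G.gauge.leftMul T,
          ∃ κ : GraphKK.KK1 G.Alg G.gauge.fixed,
            κ = GraphKK.KK1.classOf G.gauge.leftMul T h :=
  theorem4p6_general G (fun v => (hG v).1) hs
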